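/- Let $(M,d)$ be a complete metric space with a distinguished base point $0\in M$. Let $\mathrm{Lip}_0(M)$ be the Banach space of Lipschitz functions $f:M\to\mathbb R$ with $f(0)=0$, with norm the best Lipschitz constant, let $\delta(x):f\mapsto f(x)$, and let $\mathcal F(M)=\overline{\mathrm{span}}\{\delta(x):x\in M\}\subset \mathrm{Lip}_0(M)^*$ be the Lipschitz-free space. For $S\subset M$, write $\mathcal F(S)$ and $\mathrm{Lip}_0(S)$ for the spaces over $S\cup\{0\}$ with base point $0$; if $S\subset T$, then $\mathcal F(S)$ is regarded as a subset of $\mathcal F(T)$ through $\delta(x)\mapsto\delta(x)$. A series $\sum_n x_n$ in a Banach space $X$ is WUC if $\sum_n|x^*(x_n)|<\infty$ for every $x^*\in X^*$. A set $\Gamma\subset X$ is a (V$^*$)-set with respect to $X$ if $\lim_n\sup_{x\in\Gamma}|x_n^*(x)|=0$ for every WUC series $\sum_n x_n^*$ in $X^*$. The space $X$ has property (V$^*$) if the weak closure of every (V$^*$)-set with respect to $X$ is weakly compact. Suppose that $M$ satisfies at least one of the following conditions: (a) For every compact $K\subset M$ and every $\Gamma\subset\mathcal F(K)$: if $\Gamma$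 is a (V$^*$)-set with respect to $\mathcal F(\overline U)$ for every open $U\supset K$, then $\Gamma$ is a (V$^*$)-set with respect to $\mathcal F(L)$ for some compact $L$ with $K\subset L\subset M$. (b) For every compact $K\subset M$ and every WUC series $\sum_n f_n$ in $\mathrm{Lip}_0(K)$ there is a WUC series $\sum_n g_n$ in $\mathrm{Lip}_0(M)$ such that, for every $n$, $g_n$ extends $f_n$. (c) For every compact $K\subset M$, every Lipschitz map $\varphi:K\to\ell_1$ extends to a Lipschitz map $\Phi:M\to\ell_1$. (d) For every compact $K\subset M$ there is a bounded linear operator $E:\mathrm{Lip}_0(K)\to\mathrm{Lip}_0(M)$ such that $E(f)$ extends $f$ for every $f\in\mathrm{Lip}_0(K)$. (e) Every compact subset of $M$ is contained in a compact Lipschitz retract of $M$, that is, in a compact $L\subset M$ for which there is a Lipschitz map $\pi:M\to L$ with $\pi(x)=x$ for all $x\in L$. Then property (V$^*$) is compactly determined for $\mathcal F(M)$: if $\mathcal F(K)$ has property (V$^*$) for every compact $K\subset M$, then $\mathcal F(M)$ has property (V$^*$). -/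

import Mathlib

open Filter Topology Set
open scoped NNReal ENNReal

universe u v

noncomputable section

/-! ## WUC series, (V*)-sets and property (V*) in Banach spaces -/

section Banach

variable {X : Type u} [NormedAddCommGroup X] [NormedSpace ℝ X]

/-- The formal series `∑ x n` is weakly unconditionally Cauchy:
`∑ |φ (x n)| < ∞` for every `φ` in the dual of `X`. -/
def IsWUC (x : ℕ → X) : Prop :=
  ∀ φ : StrongDual ℝ X, Summable fun n => |φ (x n)|

/-- `Γ` is a (V*)-set with respect to `X`: `lim_n sup_{x ∈ Γ} |⟨x, x*_n⟩| = 0` for every WUC series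
`∑ x*_n` in `X*`. The supremum is taken in `[0, ∞]`. -/
def IsVStarSet (Γ : Set X) : Prop :=
  ∀ xs : ℕ → StrongDual ℝ X, IsWUC xs →
    Tendsto (fun n => ⨆ x ∈ Γ, ENNReal.ofReal |xs n x|) atTop (𝓝 0)

/-- The weak closure of `Γ` is weakly compact. -/
def IsRelWeaklyCompact (Γ : Set X) : Prop :=
  IsCompact (closure (toWeakSpace ℝ X '' Γ))

variable (X) in
/-- Property (V*): every (V*)-set is relatively weakly compact. -/
def HasPropertyVStar : Prop :=
  ∀ Γ : Set X, IsVStarSet Γ → IsRelWeaklyCompact Γ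

end Banach

/-! ## Lipschitz spaces and Lipschitz-free spaces over a metric space with base point `o` -/

section Lip

variable {M : Type u} [MetricSpace M]

/-- The vector space of real Lipschitz functions on `M` that vanish at the base point `o`. -/
def lip0Submodule (o : M) : Submodule ℝ (M → ℝ) where
  carrier := {f | (∃ C : ℝ≥0, LipschitzWith C f) ∧ f o = 0}
  zero_mem' := ⟨⟨0, LipschitzWith.const 0⟩, rfl⟩
  add_mem' := by
    rintro f g ⟨⟨C, hC⟩, hf⟩ ⟨⟨D, hD⟩, hg⟩
    exact ⟨⟨C + D, hC.add hD⟩, by simp [hf, hg]⟩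
  smul_mem' := by
    rintro c f ⟨⟨C, hC⟩, hf⟩
    refine ⟨⟨‖c‖₊ * C, LipschitzWith.of_dist_le_mul fun x y => ?_⟩, by simp [hf]⟩
    have h := hC.dist_le_mul x y
    simp only [Pi.smul_apply, smul_eq_mul, Real.dist_eq, ← mul_sub, abs_mul, NNReal.coe_mul,
      coe_nnnorm, Real.norm_eq_abs, mul_assoc] at h ⊢
    exact mul_le_mul_of_nonneg_left h (abs_nonneg c)

/-- `Lip_0(M)`, as a type of its own, so that it carries the Lipschitz norm below and not the
topology of pointwise convergence. -/
def Lip0 (o : M) : Type u := ↥(lip0Submodule o)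

namespace Lip0

variable {o : M}

instance : AddCommGroup (Lip0 o) := inferInstanceAs (AddCommGroup ↥(lip0Submodule o))

instance : Module ℝ (Lip0 o) := inferInstanceAs (Module ℝ ↥(lip0Submodule o))

instance : FunLike (Lip0 o) M ℝ := ⟨fun f => f.1, fun _ _ h => Subtype.ext h⟩

/-- The Lipschitz norm `sup_{x ≠ y} |f x - f y| / d(x, y)`
(pairs with `x = y` contribute `0 / 0 = 0`). -/
instance : Norm (Lip0 o) := ⟨fun f => ⨆ p : M × M, |f p.1 - f p.2| / dist p.1 p.2⟩

theorem norm_def (f : Lip0 o) : ‖f‖ = ⨆ p : M × M, |f p.1 - f p.2| / dist p.1 p.2 := rfl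

@[simp] theorem add_apply (f g : Lip0 o) (x : M) : (f + g) x = f x + g x := rfl

@[simp] theorem smul_apply (c : ℝ) (f : Lip0 o) (x : M) : (c • f) x = c * f x := rfl

@[simp] theorem zero_apply (x : M) : (0 : Lip0 o) x = 0 := rfl

theorem apply_base (f : Lip0 o) : f o = 0 := f.2.2

theorem exists_lipschitzWith (f : Lip0 o) : ∃ C : ℝ≥0, LipschitzWith C f := f.2.1

/-- A Lipschitz function vanishing at the base point, as an element of `Lip_0(M)`. -/
def mk (f : M → ℝ) (hf : ∃ C : ℝ≥0, LipschitzWith C f) (h0 : f o = 0) : Lip0 o := ⟨f, hf, h0⟩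

theorem bddAbove (f : Lip0 o) :
    BddAbove (range fun p : M × M => |f p.1 - f p.2| / dist p.1 p.2) := by
  obtain ⟨C, hC⟩ := f.exists_lipschitzWith
  refine ⟨C, ?_⟩
  rintro _ ⟨p, rfl⟩
  exact div_le_of_le_mul₀ dist_nonneg C.2 (by simpa [Real.dist_eq] using hC.dist_le_mul p.1 p.2)

theorem abs_sub_le (f : Lip0 o) (x y : M) : |f x - f y| ≤ ‖f‖ * dist x y := by
  rcases eq_or_ne x y with rfl | h
  · simp
  · exact (div_le_iff₀ (dist_pos.2 h)).1 (le_ciSup f.bddAbove (x, y))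

theorem norm_nonneg (f : Lip0 o) : 0 ≤ ‖f‖ :=
  Real.iSup_nonneg fun _ => div_nonneg (abs_nonneg _) dist_nonneg

theorem norm_le (f : Lip0 o) {C : ℝ} (hC : 0 ≤ C) (h : ∀ x y, |f x - f y| ≤ C * dist x y) :
    ‖f‖ ≤ C :=
  Real.iSup_le (fun p => div_le_of_le_mul₀ dist_nonneg hC (h p.1 p.2)) hC

theorem normCore : NormedSpace.Core ℝ (Lip0 o) where
  norm_nonneg := norm_nonneg
  norm_smul c f := by
    simp only [norm_def, smul_apply, ← mul_sub, abs_mul, mul_div_assoc, Real.norm_eq_abs]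
    exact (Real.mul_iSup_of_nonneg (abs_nonneg c) _).symm
  norm_triangle f g := by
    refine norm_le _ (add_nonneg f.norm_nonneg g.norm_nonneg) fun x y => ?_
    have h1 := f.abs_sub_le x y
    have h2 := g.abs_sub_le x y
    have h3 := abs_add_le (f x - f y) (g x - g y)
    have h4 : (f + g) x - (f + g) y = (f x - f y) + (g x - g y) := by
      simp only [add_apply]; ring
    rw [h4, add_mul]
    linarith
  norm_eq_zero_iff f := by
    constructor
    · intro h
      refine DFunLike.ext _ _ fun x => ?_
      have := f.abs_sub_le x o
      rw [h, zero_mul, f.apply_base, sub_zero] at this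
      exact abs_nonpos_iff.1 this
    · rintro rfl
      simp [norm_def]

instance : NormedAddCommGroup (Lip0 o) := NormedAddCommGroup.ofCore normCore

instance : NormedSpace ℝ (Lip0 o) := NormedSpace.ofCore normCore

/-- The evaluation functional `δ(x) : f ↦ f x` on `Lip_0(M)`. -/
def delta (o x : M) : StrongDual ℝ (Lip0 o) :=
  LinearMap.mkContinuous
    { toFun := fun f => f x
      map_add' := fun _ _ => rfl
      map_smul' := fun _ _ => rfl } (dist x o) (fun f => by
        have h := f.abs_sub_le x o
        rw [f.apply_base, sub_zero, mul_comm] at h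
        exact h)

/-- Composition `f ↦ f ∘ φ` with a Lipschitz map `φ` that preserves base points. -/
def compOp {N : Type v} [MetricSpace N] {o : M} {q : N} (φ : M → N)
    (hφ : ∃ C : ℝ≥0, LipschitzWith C φ) (h0 : φ o = q) : Lip0 q →L[ℝ] Lip0 o :=
  LinearMap.mkContinuousOfExistsBound
    { toFun := fun f => mk (fun x => f (φ x))
        (by
          obtain ⟨C, hC⟩ := hφ
          obtain ⟨D, hD⟩ := f.exists_lipschitzWith
          exact ⟨D * C, hD.comp hC⟩)
        (by rw [h0, f.apply_base])
      map_add' := fun _ _ => rfl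
      map_smul' := fun _ _ => rfl } (by
        obtain ⟨C, hC⟩ := hφ
        refine ⟨C, fun f => norm_le _ (mul_nonneg C.2 f.norm_nonneg) fun x y => ?_⟩
        refine (f.abs_sub_le (φ x) (φ y)).trans ?_
        have h := mul_le_mul_of_nonneg_left (hC.dist_le_mul x y) f.norm_nonneg
        calc _ ≤ _ := h
          _ = _ := by ring)

end Lip0

/-- The Lipschitz-free space `F(M)`: the closed linear span of the evaluation functionals `δ(x)`,
`x ∈ M`, in the dual of `Lip_0(M)`, with the dual norm. -/
abbrev lipFree (o : M) : Submodule ℝ (StrongDual ℝ (Lip0 o)) :=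
  (Submodule.span ℝ (range (Lip0.delta o))).topologicalClosure

/-- The type of elements of `F(M)`. -/
abbrev LipFree (o : M) : Type u := ↥(lipFree o)

/-- The linearization `F(M) → F(N)`, `δ(x) ↦ δ(φ x)`, of a Lipschitz map `φ : M → N` that preserves
base points: the restriction to `F(M)` of the adjoint of `f ↦ f ∘ φ`. -/
def LipFree.map {N : Type v} [MetricSpace N] {o : M} {q : N} (φ : M → N)
    (hφ : ∃ C : ℝ≥0, LipschitzWith C φ) (h0 : φ o = q) : LipFree o →L[ℝ] LipFree q :=
  ((ContinuousLinearMap.precomp ℝ (Lip0.compOp φ hφ h0)).comp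
    (lipFree o).subtypeL).codRestrict (lipFree q) (by
      intro m
      have hle : Submodule.span ℝ (range (Lip0.delta o)) ≤
          (Submodule.span ℝ (range (Lip0.delta q))).comap
            (ContinuousLinearMap.precomp ℝ (Lip0.compOp φ hφ h0)).toLinearMap := by
        rw [Submodule.span_le]
        rintro _ ⟨x, rfl⟩
        exact Submodule.subset_span ⟨φ x, rfl⟩
      exact map_mem_closure (f := ContinuousLinearMap.precomp ℝ (Lip0.compOp φ hφ h0))
        (ContinuousLinearMap.precomp ℝ (Lip0.compOp φ hφ h0)).continuous m.2
        fun a ha => hle ha)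

/-! ### Subsets of `M`

For a subset `S` of `M`, the pointed metric space meant by `S` is `S ∪ {o}`, with base point `o`. -/

/-- The base point of `S ∪ {o}`. -/
def base (o : M) (S : Set M) : ↥(insert o S) := ⟨o, mem_insert o S⟩

/-- `Lip_0(S ∪ {o})`. -/
abbrev Lip0On (o : M) (S : Set M) : Type u := Lip0 (base o S)

/-- `F(S ∪ {o})`. -/
abbrev LipFreeOn (o : M) (S : Set M) : Type u := LipFree (base o S)

/-- The canonical embedding of `F(S ∪ {o})` in `F(T ∪ {o})` for `S ⊆ T`, given by
`δ(x) ↦ δ(x)`. -/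
def LipFreeOn.incl (o : M) {S T : Set M} (h : S ⊆ T) : LipFreeOn o S →L[ℝ] LipFreeOn o T :=
  LipFree.map (inclusion (insert_subset_insert h)) ⟨1, fun _ _ => by simp [Subtype.edist_eq]⟩ rfl

/-- A property `P` of Banach spaces is compactly determined for `F(M)`: if `F(K ∪ {o})` has `P` for
all compact `K ⊆ M`, then `F(M)` has `P`. -/
def CompactlyDetermined
    (P : ∀ (X : Type u) [NormedAddCommGroup X] [NormedSpace ℝ X], Prop) (o : M) : Prop :=
  (∀ K : Set M, IsCompact K → P (LipFreeOn o K)) → P (LipFree o)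

end Lip

end

/-! Up to any ε, a (V*)-set Γ in F(M) is carried by a compact subset of M. As F(M)* = Lip_0(M), such
a set is tested on WUC series of Lipschitz functions, and functions of norm at most 1 with disjoint
supports form one. A gliding hump then gives tightness: Γ is uniformly small on functions vanishing
on a large ball (`exists_radius_of_isVStarSet`), and on functions that are supported in a fixed ball
and vanish near a suitable finite set (`exists_finset_of_isVStarSet`).

Tightness makes multiplication by cutoffs, with supports shrinking to a compact K, converge
uniformly on Γ. The limits form a set Γ' in F(K) within ε of Γ. Any open U ⊇ K contains the supports
of all late cutoffs, so Γ' is a uniform limit of (V*)-sets of F(closure U) and is one itself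
(`exists_compact_approx_of_isVStarSet`).

Condition (a) now places Γ' as a (V*)-set in some F(L) with L compact, where it is relatively weakly
compact by hypothesis. Hence Γ is approximated to any accuracy by relatively weakly compact sets,
and Grothendieck's criterion (`isRelWeaklyCompact_of_approx`) finishes. The other conditions imply
(a): (d) gives (b) because operators preserve WUC series; (c) gives (b) because a WUC series in
Lip_0(K) is a Lipschitz map from K to ℓ_1; (b) and (e) bring (V*)-sets of F(M) back to F(K) and
F(L). -/

/-- The dual of a normed space, with the structure on the space that comes from the norm. -/
abbrev NormedDual (X : Type u) [NormedAddCommGroup X] [NormedSpace ℝ X] : Type u := StrongDual ℝ X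

/-- Bounded operators between normed spaces, with the structures that come from the norms. -/
abbrev NormedMap (X : Type u) (Y : Type v) [NormedAddCommGroup X] [NormedSpace ℝ X]
    [NormedAddCommGroup Y] [NormedSpace ℝ Y] : Type (max u v) := X →L[ℝ] Y

/-! ### WUC series, (V*)-sets and weak compactness in Banach spaces -/

section BanachLemmas

variable {X : Type u} [NormedAddCommGroup X] [NormedSpace ℝ X]
  {Y : Type v} [NormedAddCommGroup Y] [NormedSpace ℝ Y]

theorem IsWUC.map {x : ℕ → X} (hx : IsWUC x) (T : X →L[ℝ] Y) : IsWUC fun n => T (x n) :=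
  fun φ => hx (φ.comp T)

theorem isVStarSet_iff {Γ : Set X} :
    IsVStarSet Γ ↔ ∀ xs : ℕ → StrongDual ℝ X, IsWUC xs → ∀ ε > 0,
      ∀ᶠ n in atTop, ∀ x ∈ Γ, |xs n x| ≤ ε := by
  refine forall₂_congr fun xs _ => ?_
  rw [ENNReal.tendsto_nhds_zero]
  simp only [iSup₂_le_iff]
  constructor
  · intro h ε hε
    filter_upwards [h (ENNReal.ofReal ε) (by simpa using hε)] with n hn x hx
    exact (ENNReal.ofReal_le_ofReal_iff hε.le).1 (hn x hx)
  · intro h ε hε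
    rcases eq_or_ne ε ⊤ with rfl | hne
    · simp
    filter_upwards [h ε.toReal (ENNReal.toReal_pos hε.ne' hne)] with n hn x hx
    exact ENNReal.ofReal_le_of_le_toReal (hn x hx)

theorem IsVStarSet.image {Γ : Set X} (hΓ : IsVStarSet Γ) (T : X →L[ℝ] Y) :
    IsVStarSet (T '' Γ) := by
  rw [isVStarSet_iff] at hΓ ⊢
  intro xs hxs ε hε
  filter_upwards [hΓ _ (hxs.map (ContinuousLinearMap.precomp ℝ T)) ε hε] with n hn
  rintro _ ⟨x, hx, rfl⟩
  exact hn x hx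

theorem exists_norm_le_of_forall_dual_bounded {ι : Type*} (x : ι → X)
    (h : ∀ φ : StrongDual ℝ X, ∃ C, ∀ i, |φ (x i)| ≤ C) : ∃ C, ∀ i, ‖x i‖ ≤ C := by
  obtain ⟨C, hC⟩ := banach_steinhaus
    (g := fun i => NormedSpace.inclusionInDoubleDual ℝ X (x i)) h
  exact ⟨C, fun i => (NormedSpace.inclusionInDoubleDualLi (E := X) ℝ).norm_map (x i) ▸ hC i⟩

theorem isWUC_of_norm_sum_le {x : ℕ → X} {C : ℝ}
    (h : ∀ (F : Finset ℕ) (s : ℕ → ℝ), (∀ n, |s n| ≤ 1) → ‖∑ n ∈ F, s n • x n‖ ≤ C) :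
    IsWUC x := by
  intro φ
  refine summable_of_sum_le (c := ‖φ‖ * C) (fun _ => abs_nonneg _) fun F => ?_
  have h1 : ∑ n ∈ F, |φ (x n)| = φ (∑ n ∈ F, (SignType.sign (φ (x n)) : ℝ) • x n) := by
    rw [map_sum]
    refine Finset.sum_congr rfl fun n _ => ?_
    rw [map_smul, smul_eq_mul, sign_mul_self]
  rw [h1]
  refine (le_abs_self _).trans ((φ.le_opNorm _).trans ?_)
  refine mul_le_mul_of_nonneg_left (h F _ fun n => ?_) (norm_nonneg _)
  rcases SignType.sign (φ (x n)) with _ | _ | _ <;> simp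

/-- Signed partial sums are bounded under each functional, hence in norm by the uniform boundedness
principle. -/
theorem IsWUC.exists_norm_sum_le {x : ℕ → X} (hx : IsWUC x) :
    ∃ C, ∀ (F : Finset ℕ) (s : ℕ → ℝ), (∀ n, |s n| ≤ 1) → ‖∑ n ∈ F, s n • x n‖ ≤ C := by
  obtain ⟨C, hC⟩ := exists_norm_le_of_forall_dual_bounded
    (fun p : Finset ℕ × {s : ℕ → ℝ // ∀ n, |s n| ≤ 1} => ∑ n ∈ p.1, p.2.1 n • x n) (by
      intro φ
      refine ⟨∑' n, |φ (x n)|, fun p => ?_⟩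
      rw [map_sum]
      refine (Finset.abs_sum_le_sum_abs _ _).trans (le_trans (Finset.sum_le_sum fun n _ => ?_)
        ((hx φ).sum_le_tsum p.1 fun _ _ => abs_nonneg _))
      rw [map_smul, smul_eq_mul, abs_mul]
      exact mul_le_of_le_one_left (abs_nonneg _) (p.2.2 n))
  exact ⟨C, fun F s hs => hC (F, ⟨s, hs⟩)⟩

/-- The terms of a WUC series are bounded in norm, so a small perturbation of the set changes the
suprema little, uniformly in `n`. -/
theorem isVStarSet_of_approx {Γ : Set X}
    (h : ∀ ε > 0, ∃ Γ' : Set X, IsVStarSet Γ' ∧ ∀ x ∈ Γ, ∃ y ∈ Γ', ‖x - y‖ ≤ ε) :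
    IsVStarSet Γ := by
  rw [isVStarSet_iff]
  intro xs hxs ε hε
  obtain ⟨C, hC⟩ := exists_norm_le_of_forall_dual_bounded xs fun φ =>
    ⟨∑' n, |φ (xs n)|, fun n => (hxs φ).le_tsum n fun _ _ => abs_nonneg _⟩
  have hC0 : 0 ≤ C := (norm_nonneg _).trans (hC 0)
  obtain ⟨Γ', hΓ', hap⟩ := h (ε / 2 / (C + 1)) (by positivity)
  filter_upwards [isVStarSet_iff.1 hΓ' xs hxs (ε / 2) (by positivity)] with n hn x hx
  obtain ⟨y, hy, hxy⟩ := hap x hx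
  have h1 : |xs n (x - y)| ≤ ε / 2 :=
    calc |xs n (x - y)| ≤ ‖xs n‖ * ‖x - y‖ := (xs n).le_opNorm _
      _ ≤ (C + 1) * (ε / 2 / (C + 1)) :=
        mul_le_mul ((hC n).trans (by linarith)) hxy (norm_nonneg _) (by linarith)
      _ = ε / 2 := by field_simp
  have h2 : xs n x = xs n (x - y) + xs n y := by simp
  rw [h2]
  exact (abs_add_le _ _).trans (by linarith [hn y hy])

theorem tendsto_toWeakSpace_iff {α : Type*} {l : Filter α} {f : α → X} {x : X} :
    Tendsto (fun a => toWeakSpace ℝ X (f a)) l (𝓝 (toWeakSpace ℝ X x)) ↔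
      ∀ φ : StrongDual ℝ X, Tendsto (fun a => φ (f a)) l (𝓝 (φ x)) :=
  WeakBilin.tendsto_iff_forall_eval_tendsto (topDualPairing ℝ X).flip fun x y h => by
    by_contra hne
    obtain ⟨f, hf⟩ := SeparatingDual.exists_separating_of_ne (R := ℝ) hne
    exact hf (DFunLike.congr_fun h f)

theorem isClosed_toWeakSpace_closedBall (r : ℝ) :
    IsClosed (toWeakSpace ℝ X '' Metric.closedBall 0 r) := by
  have h := (convex_closedBall (0 : X) r).toWeakSpace_closure ℝ
  rw [Metric.isClosed_closedBall.closure_eq] at h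
  exact h ▸ isClosed_closure

theorem IsRelWeaklyCompact.image {Γ : Set X} (hΓ : IsRelWeaklyCompact Γ) (T : X →L[ℝ] Y) :
    IsRelWeaklyCompact (T '' Γ) := by
  have h : IsCompact (WeakSpace.map T '' closure (toWeakSpace ℝ X '' Γ)) :=
    IsCompact.image hΓ (WeakSpace.map T).continuous
  refine h.closure_of_subset ?_
  rintro _ ⟨_, ⟨x, hx, rfl⟩, rfl⟩
  exact ⟨_, subset_closure ⟨x, hx, rfl⟩, rfl⟩

open scoped Pointwise in
/-- A set that is approximated uniformly, to any accuracy, by relatively weakly compact sets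
is relatively weakly compact. -/
theorem isRelWeaklyCompact_of_approx [CompleteSpace X] {Γ : Set X}
    (h : ∀ ε > 0, ∃ Γ' : Set X, IsRelWeaklyCompact Γ' ∧ ∀ x ∈ Γ, ∃ y ∈ Γ', ‖x - y‖ ≤ ε) :
    IsRelWeaklyCompact Γ := by
  let W := toWeakSpace ℝ X
  -- Weakly compact plus weakly closed is weakly closed, so the approximation survives passage to
  -- the weak closure.
  have key : ∀ ε > 0, ∃ K : Set (WeakSpace ℝ X), IsCompact K ∧
      ∀ w ∈ closure (W '' Γ), ∃ y ∈ K, ‖W.symm w - W.symm y‖ ≤ ε := by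
    intro ε hε
    obtain ⟨Γ', hΓ', hap⟩ := h ε hε
    refine ⟨_, hΓ', fun w hw => ?_⟩
    have hcl : IsClosed (closure (W '' Γ') + W '' Metric.closedBall 0 ε) :=
      (isClosed_toWeakSpace_closedBall ε).add_left_of_isCompact hΓ'
    have hsub : W '' Γ ⊆ closure (W '' Γ') + W '' Metric.closedBall 0 ε := by
      rintro _ ⟨x, hx, rfl⟩
      obtain ⟨y, hy, hxy⟩ := hap x hx
      exact ⟨W y, subset_closure ⟨y, hy, rfl⟩, W (x - y), ⟨x - y, by simpa using hxy, rfl⟩,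
        by simp⟩
    obtain ⟨y, hy, _, ⟨b, hb, rfl⟩, rfl⟩ := closure_minimal hsub hcl hw
    exact ⟨y, hy, by simpa using hb⟩
  unfold IsRelWeaklyCompact
  rw [isCompact_iff_ultrafilter_le_nhds]
  intro 𝒰 h𝒰
  have hA : ∀ᶠ w in (𝒰 : Filter (WeakSpace ℝ X)), w ∈ closure (W '' Γ) := le_principal_iff.1 h𝒰
  -- The ultrafilter is pushed forward into the compact set along a choice of approximants; its
  -- limit there is a weak limit of `𝒰` up to `ε`.
  have hlim : ∀ ε > 0, ∃ y : X, ∀ φ : StrongDual ℝ X, ∀ η > 0,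
      ∀ᶠ w in (𝒰 : Filter (WeakSpace ℝ X)), |φ (W.symm w) - φ y| ≤ ε * ‖φ‖ + η := by
    intro ε hε
    obtain ⟨K, hK, hap⟩ := key ε hε
    choose! f hf using hap
    obtain ⟨y, -, hy⟩ := isCompact_iff_ultrafilter_le_nhds.1 hK (𝒰.map f) (by
      rw [le_principal_iff, Ultrafilter.mem_coe, Ultrafilter.mem_map]
      filter_upwards [hA] with w hw using (hf w hw).1)
    refine ⟨W.symm y, fun φ η hη => ?_⟩
    have h1 : Tendsto (fun w => toWeakSpace ℝ X (W.symm (f w))) 𝒰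
        (𝓝 (toWeakSpace ℝ X (W.symm y))) := hy
    have h2 := tendsto_toWeakSpace_iff.1 h1 φ
    filter_upwards [hA, Metric.tendsto_nhds.1 h2 η hη] with w hw hd
    rw [Real.dist_eq] at hd
    have h3 : |φ (W.symm w - W.symm (f w))| ≤ ε * ‖φ‖ :=
      calc _ ≤ ‖φ‖ * ‖W.symm w - W.symm (f w)‖ := φ.le_opNorm _
        _ ≤ ε * ‖φ‖ := by
          rw [mul_comm]; exact mul_le_mul_of_nonneg_right (hf w hw).2 (norm_nonneg _)
    rw [map_sub] at h3
    have := abs_sub_le (φ (W.symm w)) (φ (W.symm (f w))) (φ (W.symm y))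
    linarith
  have hpos : ∀ n : ℕ, (0 : ℝ) < (1 / 2) ^ n := fun n => by positivity
  choose y hy using fun n : ℕ => hlim ((1 / 2) ^ n) (hpos n)
  -- Both points are approximate limits of the same ultrafilter, so they are close under every
  -- functional.
  have hdist : ∀ n m : ℕ, ‖y n - y m‖ ≤ (1 / 2) ^ n + (1 / 2) ^ m := by
    intro n m
    refine NormedSpace.norm_le_dual_bound ℝ _ (by positivity) fun φ => ?_
    refine le_of_forall_pos_le_add fun η hη => ?_
    obtain ⟨w, h1, h2⟩ := ((hy n φ (η / 2) (by positivity)).and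
      (hy m φ (η / 2) (by positivity))).exists
    rw [map_sub, Real.norm_eq_abs]
    have := abs_sub_le (φ (y n)) (φ (W.symm w)) (φ (y m))
    rw [abs_sub_comm (φ (y n)) (φ (W.symm w))] at this
    linarith
  have htend : Tendsto (fun n : ℕ => ((1 : ℝ) / 2) ^ n) atTop (𝓝 0) :=
    tendsto_pow_atTop_nhds_zero_of_lt_one (by norm_num) (by norm_num)
  have hcauchy : CauchySeq y := by
    refine cauchySeq_of_le_tendsto_0' (fun n : ℕ => 2 * ((1 : ℝ) / 2) ^ n) (fun n m hnm => ?_)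
      (by simpa using htend.const_mul 2)
    rw [dist_eq_norm]
    have : ((1 : ℝ) / 2) ^ m ≤ (1 / 2) ^ n :=
      pow_le_pow_of_le_one (by norm_num) (by norm_num) hnm
    linarith [hdist n m]
  obtain ⟨z, hz⟩ := cauchySeq_tendsto_of_complete hcauchy
  have hconv : Tendsto (fun w => toWeakSpace ℝ X (W.symm w)) 𝒰 (𝓝 (toWeakSpace ℝ X z)) := by
    rw [tendsto_toWeakSpace_iff]
    intro φ
    rw [Metric.tendsto_nhds]
    intro η hη
    have h1 : Tendsto (fun n => φ (y n)) atTop (𝓝 (φ z)) := (φ.continuous.tendsto z).comp hz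
    have h2 : Tendsto (fun n : ℕ => ((1 : ℝ) / 2) ^ n * ‖φ‖) atTop (𝓝 0) := by
      simpa using htend.mul_const ‖φ‖
    obtain ⟨n, hn1, hn2⟩ := ((Metric.tendsto_nhds.1 h1 (η / 4) (by positivity)).and
      (h2.eventually_lt_const (show (0 : ℝ) < η / 4 by positivity))).exists
    filter_upwards [hy n φ (η / 4) (by positivity)] with w hw
    rw [Real.dist_eq] at hn1 ⊢
    have := abs_sub_le (φ (W.symm w)) (φ (y n)) (φ z)
    linarith
  exact ⟨W z, isClosed_closure.mem_of_tendsto hconv hA, hconv⟩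

theorem exists_comp_eq_of_forall_mem_range {Z : Type*} [NormedAddCommGroup Z] [NormedSpace ℝ Z]
    (J : Z →L[ℝ] Y) (hJ : ∀ z, ‖J z‖ = ‖z‖) (T : X →L[ℝ] Y) (hT : ∀ x, ∃ z, J z = T x) :
    ∃ T' : X →L[ℝ] Z, ∀ x, J (T' x) = T x := by
  choose f hf using hT
  have hinj : Function.Injective J := by
    refine (injective_iff_map_eq_zero J).2 fun z hz => ?_
    rw [← norm_eq_zero, ← hJ, hz, norm_zero]
  refine ⟨LinearMap.mkContinuous
    { toFun := f
      map_add' := fun x y => hinj (by simp [hf])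
      map_smul' := fun c x => hinj (by simp [hf]) } ‖T‖ fun x => ?_, hf⟩
  rw [← hJ]
  exact (congrArg norm (hf x)).trans_le (T.le_opNorm x)

theorem exists_dual_ne_zero_of_notMem_range [CompleteSpace X] (J : X →L[ℝ] Y)
    (hJ : ∀ x, ‖J x‖ = ‖x‖) {y : Y} (hy : ∀ x, J x ≠ y) :
    ∃ φ : StrongDual ℝ Y, (∀ x, φ (J x) = 0) ∧ φ y ≠ 0 := by
  have hiso : Isometry J := AddMonoidHomClass.isometry_of_norm J hJ
  have hcl : IsClosed (range J) := hiso.isClosedEmbedding.isClosed_range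
  obtain ⟨φ, u, hu, hv⟩ := geometric_hahn_banach_point_closed
    (show Convex ℝ (range J) from (LinearMap.range J.toLinearMap).convex) hcl
    (x := y) (by simpa using hy)
  refine ⟨φ, fun x => ?_, fun h => ?_⟩
  · by_contra hx
    -- The multiple is chosen so that `φ` takes the value `u - 1` there, against the bound `u < φ`
    -- on the range.
    have := hv _ ⟨((u - 1) / φ (J x)) • x, rfl⟩
    rw [map_smul, map_smul, smul_eq_mul, div_mul_cancel₀ _ hx] at this
    linarith
  · have : u < 0 := by simpa using hv _ ⟨0, rfl⟩
    linarith

end BanachLemmas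

noncomputable section

/-! ### Lipschitz functions, cutoffs and the duality F(M)* = Lip_0(M) -/

section LipLemmas

variable {M : Type u} [MetricSpace M] {o : M}

namespace Lip0

@[simp] theorem sub_apply (f g : Lip0 o) (x : M) : (f - g) x = f x - g x := rfl

@[simp] theorem sum_apply {ι : Type*} (F : Finset ι) (f : ι → Lip0 o) (x : M) :
    (∑ i ∈ F, f i) x = ∑ i ∈ F, f i x :=
  map_sum (AddMonoidHom.mk' (fun g : Lip0 o => g x) fun _ _ => rfl) f F

@[simp] theorem delta_apply (x : M) (f : Lip0 o) : delta o x f = f x := rfl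

theorem exists_lipschitz_of_abs_sub_le {f : M → ℝ} {C : ℝ}
    (h : ∀ x y, |f x - f y| ≤ C * dist x y) : ∃ C : ℝ≥0, LipschitzWith C f :=
  ⟨C.toNNReal, LipschitzWith.of_dist_le_mul fun x y => (h x y).trans
    (mul_le_mul_of_nonneg_right (Real.le_coe_toNNReal C) dist_nonneg)⟩

theorem exists_of_abs_sub_le (f : M → ℝ) (h0 : f o = 0) {C : ℝ} (hC : 0 ≤ C)
    (h : ∀ x y, |f x - f y| ≤ C * dist x y) : ∃ g : Lip0 o, (∀ x, g x = f x) ∧ ‖g‖ ≤ C :=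
  ⟨mk f (exists_lipschitz_of_abs_sub_le h) h0, fun _ => rfl, norm_le _ hC h⟩

theorem abs_apply_le (f : Lip0 o) (x : M) : |f x| ≤ ‖f‖ * dist x o := by
  simpa [f.apply_base] using f.abs_sub_le x o

/-- Postcomposition with a real `1`-Lipschitz function that vanishes at `0`. -/
theorem exists_postcomp (f : Lip0 o) (s : ℝ → ℝ) (hs0 : s 0 = 0)
    (hs : ∀ a b, |s a - s b| ≤ |a - b|) :
    ∃ g : Lip0 o, (∀ x, g x = s (f x)) ∧ ‖g‖ ≤ ‖f‖ :=
  exists_of_abs_sub_le _ (by rw [f.apply_base, hs0]) (norm_nonneg f)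
    fun x y => (hs _ _).trans (f.abs_sub_le x y)

/-- McShane extension. -/
theorem exists_extension {S : Set M} (f : Lip0On o S) :
    ∃ g : Lip0 o, (∀ x : ↥(insert o S), g x = f x) ∧ ‖g‖ ≤ ‖f‖ := by
  classical
  have hf : LipschitzOnWith ‖f‖₊ (fun x => if h : x ∈ insert o S then f ⟨x, h⟩ else 0)
      (insert o S) := by
    refine LipschitzOnWith.of_dist_le_mul fun x hx y hy => ?_
    simp only [dif_pos hx, dif_pos hy]
    exact f.abs_sub_le ⟨x, hx⟩ ⟨y, hy⟩
  obtain ⟨g, hg, hgf⟩ := hf.extend_real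
  have hval : ∀ x : ↥(insert o S), g x = f x := fun x => by
    rw [← hgf x.2]
    simp only [dif_pos x.2]
  obtain ⟨G, hG, hGn⟩ := exists_of_abs_sub_le (o := o) g
    ((hval (base o S)).trans f.apply_base) (norm_nonneg f)
    fun x y => hg.dist_le_mul x y
  exact ⟨G, fun x => (hG x).trans (hval x), hGn⟩

/-- With its converse `IsWUC.exists_sum_abs_sub_le`, this identifies WUC series in Lip_0(M) with
Lipschitz maps from M to ℓ_1 that vanish at the base point. -/
theorem isWUC_of_sum_abs_sub_le {f : ℕ → Lip0 o} {C : ℝ} (hC : 0 ≤ C)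
    (h : ∀ (F : Finset ℕ) (x y : M), ∑ n ∈ F, |f n x - f n y| ≤ C * dist x y) : IsWUC f := by
  refine isWUC_of_norm_sum_le (C := C) fun F s hs => norm_le _ hC fun x y => ?_
  simp only [sum_apply, smul_apply]
  rw [← Finset.sum_sub_distrib]
  refine (Finset.abs_sum_le_sum_abs _ _).trans
    (le_trans (Finset.sum_le_sum fun n _ => ?_) (h F x y))
  rw [← mul_sub, abs_mul]
  exact mul_le_of_le_one_left (abs_nonneg _) (hs n)

theorem _root_.IsWUC.exists_sum_abs_sub_le {f : ℕ → Lip0 o} (hf : IsWUC f) :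
    ∃ C : ℝ≥0, ∀ (F : Finset ℕ) (x y : M), ∑ n ∈ F, |f n x - f n y| ≤ C * dist x y := by
  obtain ⟨C, hC⟩ := hf.exists_norm_sum_le
  refine ⟨C.toNNReal, fun F x y => ?_⟩
  let s : ℕ → ℝ := fun n => SignType.sign (f n x - f n y)
  have hs : ∀ n, |s n| ≤ 1 := fun n => by
    simp only [s]
    rcases SignType.sign (f n x - f n y) with _ | _ | _ <;> simp
  have h1 : ∑ n ∈ F, |f n x - f n y| = (∑ n ∈ F, s n • f n) x - (∑ n ∈ F, s n • f n) y := by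
    simp only [sum_apply, smul_apply]
    rw [← Finset.sum_sub_distrib]
    exact Finset.sum_congr rfl fun n _ => by rw [← mul_sub, sign_mul_self]
  rw [h1]
  refine (le_abs_self _).trans ((abs_sub_le _ x y).trans ?_)
  exact mul_le_mul_of_nonneg_right ((hC F s hs).trans (Real.le_coe_toNNReal C)) dist_nonneg

/-- A sequence of functions of norm at most `1` with disjoint supports is WUC. -/
theorem isWUC_of_disjoint {f : ℕ → Lip0 o} (hf : ∀ n, ‖f n‖ ≤ 1)
    (hd : ∀ x n m, f n x ≠ 0 → f m x ≠ 0 → n = m) : IsWUC f := by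
  classical
  -- At most one function is nonzero at `x` and at most one at `y`, which gives the constant 2.
  refine isWUC_of_sum_abs_sub_le (C := 2) zero_le_two fun F x y => ?_
  have hone : ∀ z, ∑ n ∈ F, (if f n z ≠ 0 then dist x y else 0) ≤ dist x y := fun z => by
    rw [← Finset.sum_filter, Finset.sum_const, nsmul_eq_mul]
    refine mul_le_of_le_one_left dist_nonneg ?_
    exact_mod_cast Finset.card_le_one.2 fun a ha b hb =>
      hd z a b (Finset.mem_filter.1 ha).2 (Finset.mem_filter.1 hb).2
  have hterm : ∀ n, |f n x - f n y| ≤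
      (if f n x ≠ 0 then dist x y else 0) + (if f n y ≠ 0 then dist x y else 0) := fun n => by
    have h1 : |f n x - f n y| ≤ dist x y :=
      ((f n).abs_sub_le x y).trans (mul_le_of_le_one_left dist_nonneg (hf n))
    have h2 : 0 ≤ dist x y := dist_nonneg
    by_cases hx : f n x = 0 <;> by_cases hy : f n y = 0
    · simp [hx, hy]
    · simpa [hx, hy] using h1
    · simpa [hx, hy] using h1
    · simpa [hx, hy] using h1.trans (by linarith)
  refine (Finset.sum_le_sum fun n _ => hterm n).trans ?_
  rw [Finset.sum_add_distrib]
  linarith [hone x, hone y]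

/-- A nonnegative function of norm at most `1` may be lowered, without changing its values on a
finite set `F`, so that its support lies in the balls with centre `e` and radius `g e`, `e ∈ F`. -/
theorem exists_peak (g : Lip0 o) (hg : ‖g‖ ≤ 1) (hg0 : ∀ x, 0 ≤ g x) (F : Finset M) :
    ∃ p : Lip0 o, ‖p‖ ≤ 1 ∧ (∀ x, 0 ≤ p x) ∧ (∀ x, p x ≤ g x) ∧ (∀ x ∈ F, p x = g x) ∧
      ∀ x, p x ≠ 0 → ∃ e ∈ F, dist x e < g e := by
  classical
  induction F using Finset.induction_on with
  | empty => exact ⟨0, by simp, by simp, by simpa using hg0, by simp, by simp⟩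
  | insert e F _ ih =>
    obtain ⟨p, hp, hp0, hpg, hpF, hps⟩ := ih
    -- The cone of height `g e` and slope 1 over `e` lies below `g`; the new peak function is the
    -- maximum of `p` with this cone.
    have hge : ∀ x, g e - dist x e ≤ g x := fun x => by
      have h1 := (abs_le.1 (g.abs_sub_le x e)).1
      have h2 : ‖g‖ * dist x e ≤ dist x e := mul_le_of_le_one_left dist_nonneg hg
      linarith
    have hle : ∀ x, max (p x) (max (g e - dist x e) 0) ≤ g x := fun x =>
      max_le (hpg x) (max_le (hge x) (hg0 x))
    obtain ⟨q, hq, hqn⟩ := exists_of_abs_sub_le (o := o)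
      (fun x => max (p x) (max (g e - dist x e) 0))
      (le_antisymm ((hle o).trans_eq g.apply_base) (le_max_of_le_right (le_max_right _ _)))
      zero_le_one (fun x y => by
        refine (abs_max_sub_max_le_max _ _ _ _).trans (max_le ?_ ?_)
        · exact (p.abs_sub_le x y).trans (mul_le_mul_of_nonneg_right hp dist_nonneg)
        · refine (abs_max_sub_max_le_max _ _ _ _).trans (max_le ?_ ?_)
          · rw [one_mul, sub_sub_sub_cancel_left, abs_sub_comm]
            exact abs_dist_sub_le x y e
          · simp)
    refine ⟨q, hqn, fun x => ?_, fun x => (hq x).trans_le (hle x), fun x hx => ?_, fun x hx => ?_⟩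
    · rw [hq]; exact le_max_of_le_left (hp0 x)
    · refine le_antisymm ((hq x).trans_le (hle x)) ?_
      rw [hq]
      rcases Finset.mem_insert.1 hx with rfl | hx
      · simp
      · exact le_max_of_le_left (hpF x hx).ge
    · by_cases hpx : p x = 0
      · refine ⟨e, Finset.mem_insert_self _ _, ?_⟩
        by_contra hcon
        rw [hq, hpx, max_eq_right (show g e - dist x e ≤ 0 by linarith)] at hx
        simp at hx
      · obtain ⟨e', he', h⟩ := hps x hpx
        exact ⟨e', Finset.mem_insert_of_mem he', h⟩

/-- `h` is an `L`-Lipschitz function with values in `[-1, 1]` that is supported in the ball with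
centre `o` and radius `R`. -/
structure IsCutoff (o : M) (L R : ℝ) (h : M → ℝ) : Prop where
  abs_sub_le : ∀ x y, |h x - h y| ≤ L * dist x y
  abs_le_one : ∀ x, |h x| ≤ 1
  eq_zero : ∀ x, R < dist x o → h x = 0

/-- Product rule. Although `f` may be unbounded, only pairs with a point in the ball of radius `R`
matter, and there `|f| ≤ ‖f‖ * R`. -/
theorem IsCutoff.abs_mul_sub_mul_le {L R : ℝ} {h : M → ℝ} (hh : IsCutoff o L R h) (hL : 0 ≤ L)
    (hR : 0 ≤ R) (f : Lip0 o) (x y : M) :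
    |h x * f x - h y * f y| ≤ (1 + L * R) * ‖f‖ * dist x y := by
  have hfn := norm_nonneg f
  have hd : 0 ≤ dist x y := dist_nonneg
  have key : ∀ x y, dist x o ≤ R →
      |h x * f x - h y * f y| ≤ (1 + L * R) * ‖f‖ * dist x y := by
    intro x y hx
    have e : h x * f x - h y * f y = (h x - h y) * f x + h y * (f x - f y) := by ring
    have h1 : |(h x - h y) * f x| ≤ (L * dist x y) * (‖f‖ * R) := by
      rw [abs_mul]
      exact mul_le_mul (hh.abs_sub_le x y)
        ((f.abs_apply_le x).trans (mul_le_mul_of_nonneg_left hx hfn)) (abs_nonneg _)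
        (mul_nonneg hL dist_nonneg)
    have h2 : |h y * (f x - f y)| ≤ ‖f‖ * dist x y := by
      rw [abs_mul]
      exact (mul_le_of_le_one_left (abs_nonneg _) (hh.abs_le_one y)).trans (f.abs_sub_le x y)
    rw [e]
    refine (abs_add_le _ _).trans ((add_le_add h1 h2).trans (le_of_eq ?_))
    ring
  rcases le_or_gt (dist x o) R with hx | hx
  · exact key x y hx
  rcases le_or_gt (dist y o) R with hy | hy
  · rw [abs_sub_comm, dist_comm]
    exact key y x hy
  · rw [hh.eq_zero x hx, hh.eq_zero y hy]
    simp only [zero_mul, sub_zero, abs_zero]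
    positivity

/-- Multiplication by a cutoff function. -/
def mulOp {L R : ℝ} {h : M → ℝ} (hh : IsCutoff o L R h) (hL : 0 ≤ L) (hR : 0 ≤ R) :
    NormedMap (Lip0 o) (Lip0 o) :=
  LinearMap.mkContinuous
    { toFun := fun f => mk (fun x => h x * f x)
        (exists_lipschitz_of_abs_sub_le (hh.abs_mul_sub_mul_le hL hR f))
        (by rw [f.apply_base, mul_zero])
      map_add' := fun f g => DFunLike.ext _ _ fun x => mul_add _ _ _
      map_smul' := fun c f => DFunLike.ext _ _ fun x => mul_left_comm _ _ _ } (1 + L * R)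
    fun f => norm_le _ (by positivity) (hh.abs_mul_sub_mul_le hL hR f)

section mulOp

variable {L R : ℝ} {h : M → ℝ} (hh : IsCutoff o L R h) (hL : 0 ≤ L) (hR : 0 ≤ R)

@[simp] theorem mulOp_apply (f : Lip0 o) (x : M) : mulOp hh hL hR f x = h x * f x := rfl

theorem norm_mulOp_le (f : Lip0 o) : ‖mulOp hh hL hR f‖ ≤ (1 + L * R) * ‖f‖ :=
  LinearMap.mkContinuous_norm_le _ (by positivity) _ |> (mulOp hh hL hR).le_of_opNorm_le <| f

end mulOp

end Lip0

namespace LipFree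

/-- `δ(x)` as an element of `F(M)`. -/
def dirac (o x : M) : LipFree o :=
  ⟨Lip0.delta o x, subset_closure (Submodule.subset_span ⟨x, rfl⟩)⟩

instance : CompleteSpace (LipFree o) :=
  (Submodule.isClosed_topologicalClosure _).completeSpace_coe

protected theorem norm_nonneg (μ : LipFree o) : 0 ≤ ‖μ‖ := norm_nonneg μ.1

theorem abs_apply_le (μ : LipFree o) (f : Lip0 o) : |μ.1 f| ≤ ‖μ‖ * ‖f‖ := μ.1.le_opNorm f

theorem norm_le (μ : LipFree o) {C : ℝ} (hC : 0 ≤ C) (h : ∀ f, |μ.1 f| ≤ C * ‖f‖) : ‖μ‖ ≤ C :=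
  ContinuousLinearMap.opNorm_le_bound _ hC h

theorem norm_dirac_sub_le (x y : M) : ‖dirac o x - dirac o y‖ ≤ dist x y :=
  norm_le _ dist_nonneg fun f => (f.abs_sub_le x y).trans_eq (mul_comm _ _)

theorem exists_small_of_mem_span {ν : StrongDual ℝ (Lip0 o)}
    (hν : ν ∈ Submodule.span ℝ (range (Lip0.delta o))) :
    ∃ (F : Finset M) (C : ℝ), 0 ≤ C ∧
      ∀ (f : Lip0 o) (δ : ℝ), (∀ x ∈ F, |f x| ≤ δ) → |ν f| ≤ C * δ := by
  classical
  induction hν using Submodule.span_induction with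
  | mem ν hν =>
    obtain ⟨x, rfl⟩ := hν
    exact ⟨{x}, 1, zero_le_one, fun f δ h => by simpa using h x⟩
  | zero => exact ⟨∅, 0, le_rfl, by simp⟩
  | add ν ν' _ _ ih ih' =>
    obtain ⟨F, C, hC, hF⟩ := ih
    obtain ⟨F', C', hC', hF'⟩ := ih'
    refine ⟨F ∪ F', C + C', add_nonneg hC hC', fun f δ h => (abs_add_le _ _).trans ?_⟩
    rw [add_mul]
    exact add_le_add (hF f δ fun x hx => h x (Finset.mem_union_left _ hx))
      (hF' f δ fun x hx => h x (Finset.mem_union_right _ hx))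
  | smul c ν _ ih =>
    obtain ⟨F, C, hC, hF⟩ := ih
    refine ⟨F, |c| * C, by positivity, fun f δ h => ?_⟩
    rw [show (c • ν) f = c * ν f from rfl, abs_mul, mul_assoc]
    exact mul_le_mul_of_nonneg_left (hF f δ h) (abs_nonneg c)

/-- An element of `F(M)` is small on functions of bounded norm that are small on a suitable finite
set. -/
theorem exists_finset_small (μ : LipFree o) (C : ℝ) {ε : ℝ} (hε : 0 < ε) :
    ∃ (F : Finset M) (δ : ℝ), 0 < δ ∧
      ∀ f : Lip0 o, ‖f‖ ≤ C → (∀ x ∈ F, |f x| ≤ δ) → |μ.1 f| ≤ ε := by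
  have hη : 0 < ε / 2 / (|C| + 1) := by positivity
  obtain ⟨ν, hν, hd⟩ := Metric.mem_closure_iff.1 μ.2 _ hη
  obtain ⟨F, D, hD, hF⟩ := exists_small_of_mem_span hν
  refine ⟨F, ε / 2 / (D + 1), by positivity, fun f hf hs => ?_⟩
  have h1 : |(μ.1 - ν) f| ≤ ε / 2 :=
    calc _ ≤ ‖μ.1 - ν‖ * ‖f‖ := (μ.1 - ν).le_opNorm f
      _ ≤ ε / 2 / (|C| + 1) * (|C| + 1) := by
        refine mul_le_mul (by rw [← dist_eq_norm]; exact hd.le) ?_ (norm_nonneg _) hη.le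
        linarith [le_abs_self C]
      _ = ε / 2 := by field_simp
  have h2 : |ν f| ≤ ε / 2 :=
    calc _ ≤ D * (ε / 2 / (D + 1)) := hF f _ hs
      _ ≤ (D + 1) * (ε / 2 / (D + 1)) := mul_le_mul_of_nonneg_right (by linarith) (by positivity)
      _ = ε / 2 := by field_simp
  have h3 : μ.1 f = (μ.1 - ν) f + ν f := by simp
  rw [h3]
  exact (abs_add_le _ _).trans (by linarith)

variable (o) in
/-- The canonical map `Lip_0(M) → F(M)*`. -/
def ofLip : NormedMap (Lip0 o) <| NormedDual (LipFree o) :=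
  (ContinuousLinearMap.precomp ℝ (lipFree o).subtypeL).comp
    (NormedSpace.inclusionInDoubleDual ℝ (Lip0 o))

theorem dual_eq_of_dirac {φ ψ : NormedDual (LipFree o)}
    (h : ∀ x, φ (dirac o x) = ψ (dirac o x)) : φ = ψ := by
  have hcl : Submodule.span ℝ (range (Lip0.delta o)) ≤
      (LinearMap.ker (φ - ψ).toLinearMap).map (lipFree o).subtype := by
    rw [Submodule.span_le]
    rintro _ ⟨x, rfl⟩
    exact ⟨dirac o x, by simp [h], rfl⟩
  ext μ
  obtain ⟨u, hu, hlim⟩ := mem_closure_iff_seq_limit.1 μ.2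
  choose v hv hvu using fun n => hcl (hu n)
  have h1 : Tendsto v atTop (𝓝 μ) := by
    rw [tendsto_subtype_rng]
    exact hlim.congr fun n => (hvu n).symm
  have h2 := ((φ - ψ).continuous.tendsto μ).comp h1
  have h3 : (fun n => (φ - ψ) (v n)) = fun _ => 0 := funext fun n => by simpa using hv n
  have h4 : (φ - ψ) μ = 0 :=
    tendsto_nhds_unique h2 (by rw [show (φ - ψ) ∘ v = fun _ => 0 from h3]; exact tendsto_const_nhds)
  simpa [sub_eq_zero] using h4

variable (o) in
/-- The canonical map `F(M)* → Lip_0(M)`. -/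
def toLip : NormedMap (NormedDual (LipFree o)) (Lip0 o) :=
  have key : ∀ (φ : NormedDual (LipFree o)) (x y : M),
      |φ (dirac o x) - φ (dirac o y)| ≤ ‖φ‖ * dist x y := fun φ x y => by
    rw [← map_sub]
    exact (φ.le_opNorm _).trans
      (mul_le_mul_of_nonneg_left (norm_dirac_sub_le x y) (norm_nonneg _))
  LinearMap.mkContinuous
    { toFun := fun φ => Lip0.mk (fun x => φ (dirac o x))
        (Lip0.exists_lipschitz_of_abs_sub_le (key φ))
        (by
          have : dirac o o = 0 := Subtype.ext (ContinuousLinearMap.ext fun f => f.apply_base)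
          rw [this, map_zero])
      map_add' := fun _ _ => rfl
      map_smul' := fun _ _ => rfl } 1
    fun φ => by rw [one_mul]; exact Lip0.norm_le _ (norm_nonneg _) (key φ)

theorem apply_toLip (φ : NormedDual (LipFree o)) (μ : LipFree o) : μ.1 (toLip o φ) = φ μ := by
  have : ofLip o (toLip o φ) = φ := dual_eq_of_dirac fun x => rfl
  exact DFunLike.congr_fun this μ

theorem isVStarSet_iff_lip {Γ : Set (LipFree o)} :
    IsVStarSet Γ ↔ ∀ f : ℕ → Lip0 o, IsWUC f → ∀ ε > 0, ∀ᶠ n in atTop, ∀ μ ∈ Γ,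
      |μ.1 (f n)| ≤ ε := by
  rw [isVStarSet_iff]
  constructor
  · exact fun h f hf => h _ (hf.map (ofLip o))
  · intro h xs hxs ε hε
    simpa only [apply_toLip] using h _ (hxs.map (toLip o)) ε hε

/-- The preadjoint of multiplication by a cutoff function. -/
def mulOp {L R : ℝ} {h : M → ℝ} (hh : Lip0.IsCutoff o L R h) (hL : 0 ≤ L) (hR : 0 ≤ R) :
    NormedMap (LipFree o) (LipFree o) :=
  ((ContinuousLinearMap.precomp ℝ (Lip0.mulOp hh hL hR)).comp
    (lipFree o).subtypeL).codRestrict (lipFree o) (by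
      intro m
      have hle : Submodule.span ℝ (range (Lip0.delta o)) ≤
          (Submodule.span ℝ (range (Lip0.delta o))).comap
            (ContinuousLinearMap.precomp ℝ (Lip0.mulOp hh hL hR)).toLinearMap := by
        rw [Submodule.span_le]
        rintro _ ⟨x, rfl⟩
        have hx : h x • Lip0.delta o x ∈ Submodule.span ℝ (range (Lip0.delta o)) :=
          Submodule.smul_mem _ _ (Submodule.subset_span ⟨x, rfl⟩)
        exact hx
      exact map_mem_closure (f := ContinuousLinearMap.precomp ℝ (Lip0.mulOp hh hL hR))
        (ContinuousLinearMap.precomp ℝ (Lip0.mulOp hh hL hR)).continuous m.2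
        fun a ha => hle ha)

@[simp] theorem mulOp_apply {L R : ℝ} {h : M → ℝ} (hh : Lip0.IsCutoff o L R h) (hL : 0 ≤ L)
    (hR : 0 ≤ R) (μ : LipFree o) (f : Lip0 o) :
    (mulOp hh hL hR μ).1 f = μ.1 (Lip0.mulOp hh hL hR f) := rfl

end LipFree

namespace LipFreeOn

/-- The canonical embedding of `F(S ∪ {o})` in `F(M)`. -/
def toFree (o : M) (S : Set M) : NormedMap (LipFreeOn o S) (LipFree o) :=
  LipFree.map (Subtype.val : ↥(insert o S) → M) ⟨1, LipschitzWith.subtype_val _⟩ rfl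

theorem toFree_apply_eq {S : Set M} (γ : LipFreeOn o S) {f : Lip0 o} {g : Lip0On o S}
    (h : ∀ x : ↥(insert o S), f x = g x) : (toFree o S γ).1 f = γ.1 g :=
  congrArg γ.1 (DFunLike.ext _ _ h)

/-- McShane extension does not increase the norm, so testing on Lip_0(S) and on Lip_0(M) gives the
same value. -/
theorem norm_toFree {S : Set M} (γ : LipFreeOn o S) : ‖toFree o S γ‖ = ‖γ‖ := by
  refine le_antisymm (LipFree.norm_le _ (LipFree.norm_nonneg _) fun f => ?_)
    (LipFree.norm_le _ (LipFree.norm_nonneg _) fun f => ?_)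
  · refine (LipFree.abs_apply_le γ _).trans (mul_le_mul_of_nonneg_left ?_ (LipFree.norm_nonneg _))
    exact Lip0.norm_le _ f.norm_nonneg fun x y => f.abs_sub_le x y
  · obtain ⟨g, hg, hgn⟩ := Lip0.exists_extension f
    rw [← toFree_apply_eq γ hg]
    exact (LipFree.abs_apply_le _ g).trans (mul_le_mul_of_nonneg_left hgn (LipFree.norm_nonneg _))

/-- An element of `F(M)` that annihilates the functions vanishing on `S ∪ {o}` lies in
`F(S ∪ {o})`. -/
theorem exists_toFree_eq {S : Set M} (μ : LipFree o)
    (h : ∀ f : Lip0 o, (∀ x ∈ insert o S, f x = 0) → μ.1 f = 0) :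
    ∃ γ, toFree o S γ = μ := by
  by_contra! hne
  obtain ⟨φ, h0, hφ⟩ := exists_dual_ne_zero_of_notMem_range (toFree o S) norm_toFree hne
  refine hφ ?_
  rw [← LipFree.apply_toLip]
  exact h _ fun x hx => h0 (LipFree.dirac (base o S) ⟨x, hx⟩)

end LipFreeOn

end LipLemmas

/-! ### Tightness of (V*)-sets by a gliding hump -/

section Tightness

variable {M : Type u} [MetricSpace M] {o : M}

namespace LipFree

/-- Let `P` be a class of subsets of `M` closed under finite unions, and `𝒢` a class of nonnegative
functions of norm at most `1` whose peaks over finite sets are supported in members of `P`. Then a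
(V*)-set is uniformly small on the functions in `𝒢` that vanish on a suitable member of `P`. -/
theorem exists_forall_abs_le_of_isVStarSet {Γ : Set (LipFree o)} (hΓ : IsVStarSet Γ)
    (P : Set M → Prop) (hempty : P ∅) (hunion : ∀ S T, P S → P T → P (S ∪ T))
    (𝒢 : Set (Lip0 o)) (h𝒢 : ∀ g ∈ 𝒢, ‖g‖ ≤ 1 ∧ ∀ x, 0 ≤ g x)
    (hpeak : ∀ g ∈ 𝒢, ∀ F : Finset M, ∃ S, P S ∧ ∀ x, (∃ e ∈ F, dist x e < g e) → x ∈ S)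
    {c : ℝ} (hc : 0 < c) :
    ∃ S, P S ∧ ∀ g ∈ 𝒢, (∀ x ∈ S, g x = 0) → ∀ μ ∈ Γ, |μ.1 g| ≤ c := by
  by_contra! hcon
  have step : ∀ S : {S // P S}, ∃ (p : Lip0 o) (μ : LipFree o) (T : {S // P S}),
      ‖p‖ ≤ 1 ∧ (∀ x ∈ S.1, p x = 0) ∧ (∀ x, p x ≠ 0 → x ∈ T.1) ∧ μ ∈ Γ ∧ c / 2 < |μ.1 p| := by
    rintro ⟨S, hS⟩
    obtain ⟨g, hg, hgS, μ, hμ, hgμ⟩ := hcon S hS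
    obtain ⟨hg1, hg0⟩ := h𝒢 g hg
    -- `g - p` will have norm at most 2 and vanish on `F`, so replacing `g` by its peaks costs at
    -- most `c / 2`.
    obtain ⟨F, δ, hδ, hF⟩ := exists_finset_small μ 2 (show 0 < c / 2 by positivity)
    obtain ⟨p, hp1, hp0, hpg, hpF, hps⟩ := g.exists_peak hg1 hg0 F
    obtain ⟨T, hT, hTs⟩ := hpeak g hg F
    refine ⟨p, μ, ⟨T, hT⟩, hp1, fun x hx => le_antisymm ((hpg x).trans_eq (hgS x hx)) (hp0 x),
      fun x hx => hTs x (hps x hx), hμ, ?_⟩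
    have h1 : |μ.1 (g - p)| ≤ c / 2 := by
      refine hF _ ((norm_sub_le g p).trans (by linarith)) fun x hx => ?_
      rw [Lip0.sub_apply, hpF x hx, sub_self, abs_zero]
      exact hδ.le
    have h2 : μ.1 g = μ.1 (g - p) + μ.1 p := by rw [← map_add, sub_add_cancel]
    have h3 := abs_add_le (μ.1 (g - p)) (μ.1 p)
    rw [← h2] at h3
    linarith
  choose p μ T hp1 hpS hpT hμ hc2 using step
  -- `st n` collects the supports of all earlier humps; the hump `p (st n)` vanishes on it, which
  -- makes the supports disjoint.
  let st : ℕ → {S // P S} := fun n =>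
    Nat.rec ⟨∅, hempty⟩ (fun _ S => ⟨S.1 ∪ (T S).1, hunion _ _ S.2 (T S).2⟩) n
  have hmono : Monotone fun n => (st n).1 := monotone_nat_of_le_succ fun n => subset_union_left
  have hdisj : ∀ x n m, n < m → p (st n) x ≠ 0 → p (st m) x = 0 := fun x n m hnm hx =>
    hpS _ x (hmono (Nat.succ_le_of_lt hnm) (Or.inr (hpT _ x hx)))
  have hwuc : IsWUC fun n => p (st n) := by
    refine Lip0.isWUC_of_disjoint (fun n => hp1 _) fun x n m hn hm => ?_
    rcases lt_trichotomy n m with h | h | h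
    · exact absurd (hdisj x n m h hn) hm
    · exact h
    · exact absurd (hdisj x m n h hm) hn
  obtain ⟨n, hn⟩ := (isVStarSet_iff_lip.1 hΓ _ hwuc (c / 2) (by positivity)).exists
  exact absurd (hn _ (hμ (st n))) (not_le.2 (hc2 _))

/-- Positive and negative parts and rescaling are postcompositions fixing 0, so they preserve `Q`.
The two parts account for the factor 2. -/
theorem forall_abs_le_of_nonneg {Γ : Set (LipFree o)} {Q : (M → ℝ) → Prop} {c : ℝ}
    (hQ : ∀ (f : M → ℝ) (s : ℝ → ℝ), Q f → s 0 = 0 → Q fun x => s (f x))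
    (h : ∀ f : Lip0 o, ‖f‖ ≤ 1 → (∀ x, 0 ≤ f x) → Q f → ∀ μ ∈ Γ, |μ.1 f| ≤ c) :
    ∀ f : Lip0 o, Q f → ∀ μ ∈ Γ, |μ.1 f| ≤ 2 * c * ‖f‖ := by
  have h1 : ∀ f : Lip0 o, ‖f‖ ≤ 1 → Q f → ∀ μ ∈ Γ, |μ.1 f| ≤ 2 * c := by
    intro f hf hQf μ hμ
    obtain ⟨p, hp, hpn⟩ := f.exists_postcomp (fun t => max t 0) (by simp)
      fun a b => abs_max_sub_max_le_abs _ _ _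
    obtain ⟨q, hq, hqn⟩ := f.exists_postcomp (fun t => max (-t) 0) (by simp)
      fun a b => (abs_max_sub_max_le_abs _ _ _).trans_eq (by rw [neg_sub_neg, abs_sub_comm])
    have hpq : f = p - q := DFunLike.ext _ _ fun x => by
      rw [Lip0.sub_apply, hp, hq]
      exact (max_zero_sub_max_neg_zero_eq_self (f x)).symm
    have hp' := h p (hpn.trans hf) (fun x => by rw [hp]; exact le_max_right _ _)
      ((funext hp : ⇑p = _) ▸ hQ f (fun t => max t 0) hQf (by simp)) μ hμ
    have hq' := h q (hqn.trans hf) (fun x => by rw [hq]; exact le_max_right _ _)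
      ((funext hq : ⇑q = _) ▸ hQ f (fun t => max (-t) 0) hQf (by simp)) μ hμ
    rw [hpq, map_sub]
    exact (abs_sub _ _).trans (by linarith)
  intro f hQf μ hμ
  rcases eq_or_ne f 0 with rfl | hf
  · simp
  have hn : 0 < ‖f‖ := norm_pos_iff.2 hf
  have h2 := h1 (‖f‖⁻¹ • f) (by rw [norm_smul, norm_inv, norm_norm, inv_mul_cancel₀ hn.ne'])
    (hQ f (fun t => ‖f‖⁻¹ * t) hQf (by simp)) μ hμ
  rw [map_smul, smul_eq_mul, abs_mul, abs_of_pos (inv_pos.2 hn), inv_mul_le_iff₀ hn] at h2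
  linarith

/-- A (V*)-set is uniformly small on functions that vanish on a suitable ball. -/
theorem exists_radius_of_isVStarSet {Γ : Set (LipFree o)} (hΓ : IsVStarSet Γ) {ε : ℝ}
    (hε : 0 < ε) :
    ∃ r > 0, ∀ f : Lip0 o, (∀ x, dist x o ≤ r → f x = 0) → ∀ μ ∈ Γ, |μ.1 f| ≤ ε * ‖f‖ := by
  obtain ⟨S, hS, h⟩ := exists_forall_abs_le_of_isVStarSet hΓ Bornology.IsBounded
    Bornology.isBounded_empty (fun _ _ => Bornology.IsBounded.union)
    {g | ‖g‖ ≤ 1 ∧ ∀ x, 0 ≤ g x} (fun _ hg => hg)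
    (fun g _ F => ⟨⋃ e ∈ F, Metric.ball e (g e),
      (Bornology.isBounded_biUnion_finset F).2 fun e _ => Metric.isBounded_ball,
      fun x ⟨e, he, hx⟩ => mem_iUnion₂.2 ⟨e, he, hx⟩⟩)
    (show 0 < ε / 2 by positivity)
  obtain ⟨r, hr0, hr⟩ := hS.subset_closedBall_lt 0 o
  refine ⟨r, hr0, ?_⟩
  have := forall_abs_le_of_nonneg (Γ := Γ) (c := ε / 2)
    (Q := fun f => ∀ x, dist x o ≤ r → f x = 0)
    (fun f s hf hs x hx => (congrArg s (hf x hx)).trans hs)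
    fun f hf hf0 hfr => h f ⟨hf, hf0⟩ fun x hx => hfr x (hr hx)
  rwa [mul_div_cancel₀ _ two_ne_zero] at this

/-- A (V*)-set is uniformly small on functions that are supported in a fixed ball and vanish on the
`δ`-neighbourhood of a suitable finite set. -/
theorem exists_finset_of_isVStarSet {Γ : Set (LipFree o)} (hΓ : IsVStarSet Γ) {ε δ : ℝ} (R : ℝ)
    (hε : 0 < ε) (hδ : 0 < δ) :
    ∃ E : Finset M, ∀ f : Lip0 o, (∀ x, R < dist x o → f x = 0) →
      (∀ x, ∀ e ∈ E, dist x e < δ → f x = 0) → ∀ μ ∈ Γ, |μ.1 f| ≤ ε * ‖f‖ := by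
  classical
  -- Peaks of a function bounded by `δ` live in balls of radius at most `δ`. A nonnegative function
  -- of norm at most 1 supported in the ball of radius `R` is at most `N * δ`, hence a sum of `N`
  -- layers of height `δ`.
  obtain ⟨N, hN⟩ := exists_nat_ge (R / δ)
  obtain ⟨S, ⟨E, hE⟩, h⟩ := exists_forall_abs_le_of_isVStarSet hΓ
    (fun S => ∃ E : Finset M, ∀ x ∈ S, ∃ e ∈ E, dist x e < δ)
    ⟨∅, by simp⟩
    (fun S T ⟨E, hE⟩ ⟨E', hE'⟩ => ⟨E ∪ E', fun x hx => by
      rcases hx with hx | hx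
      · obtain ⟨e, he, hd⟩ := hE x hx
        exact ⟨e, Finset.mem_union_left _ he, hd⟩
      · obtain ⟨e, he, hd⟩ := hE' x hx
        exact ⟨e, Finset.mem_union_right _ he, hd⟩⟩)
    {g | ‖g‖ ≤ 1 ∧ ∀ x, 0 ≤ g x ∧ g x ≤ δ} (fun g hg => ⟨hg.1, fun x => (hg.2 x).1⟩)
    (fun g hg F => ⟨{x | ∃ e ∈ F, dist x e < g e},
      ⟨F, fun x ⟨e, he, hx⟩ => ⟨e, he, hx.trans_le (hg.2 e).2⟩⟩, fun x hx => hx⟩)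
    (show 0 < ε / (2 * (N + 1)) by positivity)
  refine ⟨E, fun f hfR hfE => ?_⟩
  have key := forall_abs_le_of_nonneg (Γ := Γ) (c := ε / 2) (o := o)
    (Q := fun f => (∀ x, R < dist x o → f x = 0) ∧ ∀ x, ∀ e ∈ E, dist x e < δ → f x = 0)
    (fun f s hf hs => ⟨fun x hx => (congrArg s (hf.1 x hx)).trans hs,
      fun x e he hx => (congrArg s (hf.2 x e he hx)).trans hs⟩) ?_ f ⟨hfR, hfE⟩
  · rwa [mul_div_cancel₀ _ two_ne_zero] at key
  intro f hf hf0 ⟨hR, hE'⟩ μ hμ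
  have hfle : ∀ x, f x ≤ N * δ := fun x => by
    rcases lt_or_ge R (dist x o) with hx | hx
    · rw [hR x hx]; positivity
    · have h1 := (le_abs_self _).trans (f.abs_apply_le x)
      have h2 : ‖f‖ * dist x o ≤ dist x o := mul_le_of_le_one_left dist_nonneg hf
      have h3 := (div_le_iff₀ hδ).1 hN
      linarith
  have hs : ∀ j : ℕ, ∃ g : Lip0 o, (∀ x, g x = max 0 (min (f x - j * δ) δ)) ∧ ‖g‖ ≤ ‖f‖ :=
    fun j => f.exists_postcomp (fun t => max 0 (min (t - j * δ) δ))
      (max_eq_left (min_le_of_left_le (by rw [zero_sub, neg_nonpos]; positivity)))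
      fun a b => by
        rw [max_comm 0, max_comm 0]
        refine (abs_max_sub_max_le_abs _ _ _).trans ((abs_min_sub_min_le_max _ _ _ _).trans ?_)
        simp
  choose g hg hgn using hs
  have hsum : f = ∑ j ∈ Finset.range N, g j := DFunLike.ext _ _ fun x => by
    have hterm : ∀ j : ℕ, g j x = min (f x) ((j + 1 : ℕ) * δ) - min (f x) (j * δ) := fun j => by
      rw [hg]
      push_cast
      rcases le_total (f x) (j * δ) with h1 | h1
      · rw [min_eq_left h1, min_eq_left (by linarith), min_eq_left (by linarith),
          max_eq_left (by linarith), sub_self]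
      · rcases le_total (f x) ((j + 1) * δ) with h2 | h2
        · rw [min_eq_right h1, min_eq_left h2, min_eq_left (by linarith),
            max_eq_right (by linarith)]
        · rw [min_eq_right h1, min_eq_right h2, min_eq_right (by linarith),
            max_eq_right hδ.le]
          ring
    rw [Lip0.sum_apply, Finset.sum_congr rfl fun j _ => hterm j,
      Finset.sum_range_sub (fun j : ℕ => min (f x) (j * δ)), min_eq_left (hfle x)]
    simp [hf0 x]
  have hgμ : ∀ j, |μ.1 (g j)| ≤ ε / (2 * (N + 1)) := fun j => by
    refine h (g j) ⟨(hgn j).trans hf, fun x => ?_⟩ (fun x hx => ?_) μ hμ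
    · rw [hg]
      exact ⟨le_max_left _ _, max_le hδ.le (min_le_right _ _)⟩
    · obtain ⟨e, he, hd⟩ := hE x hx
      rw [hg, hE' x e he hd]
      exact max_eq_left (min_le_of_left_le (by rw [zero_sub, neg_nonpos]; positivity))
  rw [hsum, map_sum]
  refine (Finset.abs_sum_le_sum_abs _ _).trans ((Finset.sum_le_sum fun j _ => hgμ j).trans ?_)
  rw [Finset.sum_const, Finset.card_range, nsmul_eq_mul]
  calc (N : ℝ) * (ε / (2 * (N + 1))) ≤ (N + 1) * (ε / (2 * (N + 1))) :=
        mul_le_mul_of_nonneg_right (by linarith) (by positivity)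
    _ = ε / 2 := by field_simp

end LipFree

end Tightness

/-! ### Reduction of (V*)-sets to compact sets -/

section CompactReduction

theorem tendsto_div_two_pow_atTop_nhds_zero (C : ℝ) :
    Tendsto (fun n : ℕ => C / 2 ^ n) atTop (𝓝 0) :=
  tendsto_const_nhds.div_atTop (tendsto_pow_atTop_atTop_of_one_lt one_lt_two)

theorem norm_sub_le_of_intermediate {Y : Type u} [NormedAddCommGroup Y] (a b c : Y) :
    ‖a - c‖ ≤ ‖b - a‖ + ‖c - b‖ := by
  rw [norm_sub_rev b, norm_sub_rev c]
  exact norm_sub_le_norm_sub_add_norm_sub a b c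

theorem exists_norm_sub_le_of_geometric {Y : Type u} [NormedAddCommGroup Y] [CompleteSpace Y]
    {t : ℕ → Y} {C : ℝ} (h : ∀ n, ‖t (n + 1) - t n‖ ≤ C / 2 / 2 ^ n) :
    ∃ y, ∀ n, ‖y - t n‖ ≤ C / 2 ^ n := by
  have h' : ∀ n, dist (t n) (t (n + 1)) ≤ C / 2 / 2 ^ n := fun n => by
    rw [dist_comm, dist_eq_norm]; exact h n
  obtain ⟨y, hy⟩ := cauchySeq_tendsto_of_complete (cauchySeq_of_le_geometric_two h')
  refine ⟨y, fun n => ?_⟩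
  rw [← dist_eq_norm, dist_comm]
  exact dist_le_of_le_geometric_two_of_tendsto h' hy n

variable {M : Type u} [MetricSpace M]

section TotallyBounded

variable {E : ℕ → Finset M} {ρ : ℕ → ℝ}

/-- For each `k` the ultrafilter contains one of finitely many balls of radius `ρ k`, so it is
Cauchy. -/
theorem Ultrafilter.exists_le_nhds_of_forall_mem_biUnion_closedBall [CompleteSpace M]
    (hρ : Tendsto ρ atTop (𝓝 0))
    (𝒰 : Ultrafilter M) (h𝒰 : ∀ k, ⋃ e ∈ E k, Metric.closedBall e (ρ k) ∈ 𝒰) :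
    ∃ x ∈ ⋂ k, ⋃ e ∈ E k, Metric.closedBall e (ρ k), (𝒰 : Filter M) ≤ 𝓝 x := by
  have hc : Cauchy (𝒰 : Filter M) := by
    refine Metric.cauchy_iff.2 ⟨inferInstance, fun ε hε => ?_⟩
    obtain ⟨k, hk⟩ := (hρ.eventually_lt_const (show (0 : ℝ) < ε / 2 by positivity)).exists
    obtain ⟨e, -, he⟩ := (Ultrafilter.finite_biUnion_mem_iff (E k).finite_toSet).1 (h𝒰 k)
    refine ⟨_, he, fun x hx y hy => ?_⟩
    have := dist_triangle_right x y e
    rw [Metric.mem_closedBall] at hx hy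
    linarith
  obtain ⟨x, hx⟩ := CompleteSpace.complete hc
  refine ⟨x, mem_iInter.2 fun k => ?_, hx⟩
  have hcl : IsClosed (⋃ e ∈ E k, Metric.closedBall e (ρ k)) :=
    (E k).finite_toSet.isClosed_biUnion fun e _ => Metric.isClosed_closedBall
  exact hcl.mem_of_tendsto (f := id) hx (h𝒰 k)

theorem isCompact_iInter_biUnion_closedBall [CompleteSpace M] (hρ : Tendsto ρ atTop (𝓝 0)) :
    IsCompact (⋂ k, ⋃ e ∈ E k, Metric.closedBall e (ρ k)) :=
  isCompact_iff_ultrafilter_le_nhds.2 fun 𝒰 h𝒰 =>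
    𝒰.exists_le_nhds_of_forall_mem_biUnion_closedBall hρ fun k =>
      mem_of_superset (le_principal_iff.1 h𝒰) (iInter_subset _ k)

/-- Otherwise an ultrafilter limit of counterexamples would lie in the intersection and outside `U`.
-/
theorem exists_forall_mem_of_iInter_biUnion_closedBall_subset [CompleteSpace M]
    (hρ : Tendsto ρ atTop (𝓝 0)) {U : Set M}
    (hU : IsOpen U) (hKU : ⋂ k, ⋃ e ∈ E k, Metric.closedBall e (ρ k) ⊆ U) :
    ∃ n, ∀ x, (∀ k < n, x ∈ ⋃ e ∈ E k, Metric.closedBall e (ρ k)) → x ∈ U := by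
  by_contra! hcon
  choose x hx hxU using hcon
  let 𝒰 := Ultrafilter.of (map x atTop)
  obtain ⟨y, hy, hlim⟩ := 𝒰.exists_le_nhds_of_forall_mem_biUnion_closedBall (E := E)
    hρ fun k => Ultrafilter.of_le _ 
      ((eventually_gt_atTop k).mono fun n hn => hx n k hn :
        ∀ᶠ n in atTop, x n ∈ ⋃ e ∈ E k, Metric.closedBall e (ρ k))
  have h1 : Uᶜ ∈ 𝒰 :=
    Ultrafilter.of_le _ (Eventually.of_forall hxU : ∀ᶠ n in atTop, x n ∈ Uᶜ)
  exact (hU.isClosed_compl.mem_of_tendsto (f := id) hlim h1) (hKU hy)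

end TotallyBounded

/-- The continuous function with value `1` on `(-∞, ρ]` and `0` on `[2 * ρ, ∞)` that is affine in
between. -/
def ramp (ρ t : ℝ) : ℝ := max 0 (min 1 (2 - t / ρ))

theorem ramp_nonneg (ρ t : ℝ) : 0 ≤ ramp ρ t := le_max_left _ _

theorem ramp_le_one (ρ t : ℝ) : ramp ρ t ≤ 1 := max_le zero_le_one (min_le_left _ _)

theorem abs_ramp_le_one (ρ t : ℝ) : |ramp ρ t| ≤ 1 :=
  (abs_of_nonneg (ramp_nonneg ρ t)).trans_le (ramp_le_one ρ t)

theorem ramp_eq_one {ρ t : ℝ} (hρ : 0 < ρ) (h : t ≤ ρ) : ramp ρ t = 1 := by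
  have : t / ρ ≤ 1 := (div_le_one hρ).2 h
  rw [ramp, min_eq_left (by linarith), max_eq_right zero_le_one]

theorem ramp_eq_zero {ρ t : ℝ} (hρ : 0 < ρ) (h : 2 * ρ ≤ t) : ramp ρ t = 0 := by
  have : 2 ≤ t / ρ := (le_div_iff₀ hρ).2 h
  rw [ramp, min_eq_right (by linarith), max_eq_left (by linarith)]

theorem abs_ramp_sub_le {ρ : ℝ} (hρ : 0 < ρ) (s t : ℝ) :
    |ramp ρ s - ramp ρ t| ≤ ρ⁻¹ * |s - t| := by
  rw [ramp, ramp, max_comm 0, max_comm 0, min_comm 1, min_comm 1]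
  refine (abs_max_sub_max_le_abs _ _ _).trans ((abs_min_sub_min_le_max _ _ _ _).trans ?_)
  rw [sub_self, abs_zero, sub_sub_sub_cancel_left, ← sub_div, abs_div, abs_of_pos hρ,
    abs_sub_comm, div_eq_inv_mul]
  exact max_le le_rfl (by positivity)

namespace Lip0

variable {o : M}

theorem isCutoff_ramp_dist {r : ℝ} (hr : 0 < r) :
    IsCutoff o r⁻¹ (2 * r) fun x => ramp r (dist x o) where
  abs_sub_le x y := (abs_ramp_sub_le hr _ _).trans
    (mul_le_mul_of_nonneg_left (abs_dist_sub_le x y o) (inv_nonneg.2 hr.le))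
  abs_le_one _ := abs_ramp_le_one _ _
  eq_zero _ hx := ramp_eq_zero hr hx.le

theorem IsCutoff.mul_ramp_infDist {L R : ℝ} {h : M → ℝ} (hh : IsCutoff o L R h) {δ : ℝ}
    (hδ : 0 < δ) (E : Set M) :
    IsCutoff o (L + δ⁻¹) R fun x => h x * ramp δ (Metric.infDist x E) where
  abs_sub_le x y := by
    have h1 : |ramp δ (Metric.infDist x E) - ramp δ (Metric.infDist y E)| ≤ δ⁻¹ * dist x y := by
      refine (abs_ramp_sub_le hδ _ _).trans (mul_le_mul_of_nonneg_left ?_ (inv_nonneg.2 hδ.le))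
      simpa [Real.dist_eq] using (Metric.lipschitz_infDist_pt E).dist_le_mul x y
    have e : h x * ramp δ (Metric.infDist x E) - h y * ramp δ (Metric.infDist y E) =
        (h x - h y) * ramp δ (Metric.infDist x E) +
          h y * (ramp δ (Metric.infDist x E) - ramp δ (Metric.infDist y E)) := by ring
    rw [e, add_mul]
    refine (abs_add_le _ _).trans (add_le_add ?_ ?_) <;> rw [abs_mul]
    · exact (mul_le_of_le_one_right (abs_nonneg _) (abs_ramp_le_one _ _)).trans (hh.abs_sub_le x y)
    · exact (mul_le_of_le_one_left (abs_nonneg _) (hh.abs_le_one y)).trans h1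
  abs_le_one x := by
    rw [abs_mul]
    exact mul_le_one₀ (hh.abs_le_one x) (abs_nonneg _) (abs_ramp_le_one _ _)
  eq_zero x hx := by rw [hh.eq_zero x hx, zero_mul]

end Lip0

namespace LipFree

variable {o : M}

/-- Multiplication by suitable cutoff functions whose supports shrink to a compact set converges
rapidly, uniformly on a given (V*)-set. -/
theorem exists_cutoffs_of_isVStarSet [CompleteSpace M] {Γ : Set (LipFree o)} (hΓ : IsVStarSet Γ)
    {ε : ℝ} (hε : 0 < ε) :
    ∃ (K : Set M) (R : ℝ) (L : ℕ → ℝ) (H : ℕ → M → ℝ) (hR : 0 ≤ R) (hL : ∀ n, 0 ≤ L n)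
      (hH : ∀ n, Lip0.IsCutoff o (L n) R (H n)), IsCompact K ∧
      (∀ U, IsOpen U → K ⊆ U → ∃ N, ∀ n ≥ N, ∀ x, H n x ≠ 0 → x ∈ U) ∧
      ∀ μ ∈ Γ, ‖mulOp (hH 0) (hL 0) hR μ - μ‖ ≤ ε ∧
        ∀ n, ‖mulOp (hH (n + 1)) (hL (n + 1)) hR μ - mulOp (hH n) (hL n) hR μ‖ ≤
          ε / 2 / 2 ^ n := by
  classical
  -- The first cutoff has operator norm at most `1 + r⁻¹ * (2 * r) = 3`, so its difference from the
  -- identity has norm at most 4; hence `ε / 4`.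
  obtain ⟨r, hr, hΓr⟩ := exists_radius_of_isVStarSet hΓ (show 0 < ε / 4 by positivity)
  have hR : 0 ≤ 2 * r := by positivity
  let δ : ℕ → ℝ := fun k => 1 / 2 ^ k
  have hδ : ∀ k, 0 < δ k := fun k => by positivity
  have hδ0 : Tendsto (fun k => 2 * δ k) atTop (𝓝 0) := by
    simpa [δ] using (tendsto_div_two_pow_atTop_nhds_zero 1).const_mul 2
  let L : ℕ → ℝ := fun n => Nat.rec r⁻¹ (fun k a => a + (δ k)⁻¹) n
  have hL : ∀ n, 0 ≤ L n := fun n => by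
    induction n with
    | zero => exact inv_nonneg.2 hr.le
    | succ n ih => exact add_nonneg ih (inv_nonneg.2 (hδ n).le)
  -- `c n` bounds the difference of consecutive multiplication operators. It does not depend on the
  -- finite sets, so their accuracy can be prescribed beforehand.
  let c : ℕ → ℝ := fun n => (1 + L (n + 1) * (2 * r)) + (1 + L n * (2 * r))
  have hc : ∀ n, 0 < c n := fun n => by
    have h1 := mul_nonneg (hL n) hR
    have h2 := mul_nonneg (hL (n + 1)) hR
    simp only [c]
    linarith
  have hpos : ∀ n, 0 < ε / 2 / 2 ^ n / c n := fun n => div_pos (by positivity) (hc n)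
  choose E₀ hE₀ using fun n => exists_finset_of_isVStarSet hΓ (2 * r) (hpos n) (hδ n)
  -- Inserting `o` keeps the sets nonempty; `Metric.infDist` to the empty set would be 0.
  let E : ℕ → Finset M := fun n => insert o (E₀ n)
  let H : ℕ → M → ℝ := fun n => Nat.rec (fun x => ramp r (dist x o))
    (fun k h x => h x * ramp (δ k) (Metric.infDist x (E k))) n
  have hH : ∀ n, Lip0.IsCutoff o (L n) (2 * r) (H n) := fun n => by
    induction n with
    | zero => exact Lip0.isCutoff_ramp_dist hr
    | succ n ih => exact ih.mul_ramp_infDist (hδ n) _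
  have hsupp : ∀ n x, H n x ≠ 0 → ∀ k < n, x ∈ ⋃ e ∈ E k, Metric.closedBall e (2 * δ k) := by
    intro n x
    induction n with
    | zero => intro _ k hk; exact absurd hk (Nat.not_lt_zero k)
    | succ n ih =>
      intro hx k hk
      rcases Nat.lt_succ_iff_lt_or_eq.1 hk with hk | rfl
      · exact ih (left_ne_zero_of_mul hx) k hk
      · have h1 : Metric.infDist x (E k) < 2 * δ k := by
          by_contra hcon
          exact right_ne_zero_of_mul hx (ramp_eq_zero (hδ k) (not_lt.1 hcon))
        obtain ⟨e, he, hd⟩ := (Metric.infDist_lt_iff ⟨o, by simp [E]⟩).1 h1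
        exact mem_iUnion₂.2 ⟨e, he, hd.le⟩
  refine ⟨⋂ k, ⋃ e ∈ E k, Metric.closedBall e (2 * δ k), 2 * r, L, H, hR, hL, hH,
    isCompact_iInter_biUnion_closedBall hδ0, fun U hU hKU => ?_, fun μ hμ => ⟨?_, fun n => ?_⟩⟩
  · obtain ⟨N, hN⟩ := exists_forall_mem_of_iInter_biUnion_closedBall_subset hδ0 hU hKU
    exact ⟨N, fun n hn x hx => hN x fun k hk => hsupp n x hx k (hk.trans_le hn)⟩
  · refine norm_le _ hε.le fun f => ?_
    have h1 : (mulOp (hH 0) (hL 0) hR μ - μ).1 f =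
        μ.1 (Lip0.mulOp (hH 0) (hL 0) hR f - f) := (map_sub μ.1 _ _).symm
    have h2 : ‖Lip0.mulOp (hH 0) (hL 0) hR f - f‖ ≤ 4 * ‖f‖ := by
      refine (norm_sub_le _ _).trans ?_
      have h3 := Lip0.norm_mulOp_le (hH 0) (hL 0) hR f
      have h4 : L 0 * (2 * r) = 2 := by
        change r⁻¹ * (2 * r) = 2
        field_simp
      rw [h4] at h3
      linarith
    rw [h1]
    refine (hΓr _ (fun x hx => ?_) μ hμ).trans ?_
    · have h0 : H 0 x = 1 := ramp_eq_one hr hx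
      rw [Lip0.sub_apply, Lip0.mulOp_apply, h0, one_mul, sub_self]
    · refine (mul_le_mul_of_nonneg_left h2 (by positivity)).trans (le_of_eq ?_)
      ring
  · refine norm_le _ (by positivity) fun f => ?_
    have h1 : (mulOp (hH (n + 1)) (hL (n + 1)) hR μ - mulOp (hH n) (hL n) hR μ).1 f =
        μ.1 (Lip0.mulOp (hH (n + 1)) (hL (n + 1)) hR f - Lip0.mulOp (hH n) (hL n) hR f) :=
      (map_sub μ.1 _ _).symm
    have h2 : ‖Lip0.mulOp (hH (n + 1)) (hL (n + 1)) hR f - Lip0.mulOp (hH n) (hL n) hR f‖ ≤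
        c n * ‖f‖ := by
      refine (norm_sub_le _ _).trans ?_
      rw [add_mul]
      exact add_le_add (Lip0.norm_mulOp_le _ _ _ f) (Lip0.norm_mulOp_le _ _ _ f)
    rw [h1]
    refine (hE₀ n _ (fun x hx => ?_) (fun x e he hx => ?_) μ hμ).trans ?_
    · rw [Lip0.sub_apply, Lip0.mulOp_apply, Lip0.mulOp_apply, (hH (n + 1)).eq_zero x hx,
        (hH n).eq_zero x hx, sub_self]
    · have h3 : H (n + 1) x = H n x := by
        change H n x * ramp (δ n) (Metric.infDist x (E n)) = H n x
        rw [ramp_eq_one (hδ n), mul_one]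
        exact (Metric.infDist_le_dist_of_mem (Finset.mem_insert_of_mem he)).trans hx.le
      rw [Lip0.sub_apply, Lip0.mulOp_apply, Lip0.mulOp_apply, h3, sub_self]
    · refine (mul_le_mul_of_nonneg_left h2 (hpos n).le).trans (le_of_eq ?_)
      rw [← mul_assoc, div_mul_cancel₀ _ (hc n).ne']

/-- Up to `ε`, a (V*)-set `Γ` in `F(M)` is the image of a set `Γ'` in `F(K)` with `K` compact, such
that `Γ'` is a (V*)-set with respect to `F(closure U)` for every open `U ⊇ K`. -/
theorem exists_compact_approx_of_isVStarSet [CompleteSpace M] {Γ : Set (LipFree o)}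
    (hΓ : IsVStarSet Γ) {ε : ℝ} (hε : 0 < ε) :
    ∃ (K : Set M) (Γ' : Set (LipFreeOn o K)), IsCompact K ∧
      (∀ U : Set M, IsOpen U → ∀ hKU : K ⊆ U,
        IsVStarSet (LipFreeOn.incl o (hKU.trans subset_closure : K ⊆ closure U) '' Γ')) ∧
      ∀ μ ∈ Γ, ∃ γ ∈ Γ', ‖μ - LipFreeOn.toFree o K γ‖ ≤ ε := by
  obtain ⟨K, R, L, H, hR, hL, hH, hK, hU, hlim⟩ :=
    exists_cutoffs_of_isVStarSet hΓ (show 0 < ε / 2 by positivity)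
  let T : ℕ → NormedMap (LipFree o) (LipFree o) := fun n => mulOp (hH n) (hL n) hR
  have hγ : ∀ μ ∈ Γ, ∃ γ : LipFreeOn o K, ∀ n,
      ‖LipFreeOn.toFree o K γ - T n μ‖ ≤ ε / 2 / 2 ^ n := by
    intro μ hμ
    obtain ⟨τ, hτ⟩ := exists_norm_sub_le_of_geometric (t := fun n => T n μ) (hlim μ hμ).2
    suffices ∃ γ, LipFreeOn.toFree o K γ = τ by
      obtain ⟨γ, rfl⟩ := this
      exact ⟨γ, hτ⟩
    refine LipFreeOn.exists_toFree_eq τ fun f hf => ?_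
    refine abs_nonpos_iff.1 (le_of_forall_pos_le_add fun η hη => ?_)
    rw [zero_add]
    obtain ⟨F, δ, hδ, hF⟩ := exists_finset_small τ ‖f‖ hη
    -- `c` truncates `f` at height `δ`. It is small on `F`, and `f - c` vanishes on the open set
    -- `|f| < δ` containing `K`, hence is killed by all late cutoffs and by their limit `τ`.
    obtain ⟨c, hc, hcn⟩ := f.exists_postcomp (fun t => max (min t δ) (-δ))
      (by rw [min_eq_left hδ.le, max_eq_left (by linarith)]) fun a b => by
        refine (abs_max_sub_max_le_abs _ _ _).trans ((abs_min_sub_min_le_max _ _ _ _).trans ?_)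
        simp
    have hfc : τ.1 (f - c) = 0 := by
      have hcont : Continuous f := by
        obtain ⟨C, hC⟩ := f.exists_lipschitzWith
        exact hC.continuous
      obtain ⟨N, hN⟩ := hU {x | |f x| < δ} (isOpen_lt hcont.abs continuous_const)
        fun x hx => by simpa [hf x (mem_insert_of_mem _ hx)] using hδ
      have hT : ∀ n ≥ N, (T n μ).1 (f - c) = 0 := fun n hn => by
        have h0 : Lip0.mulOp (hH n) (hL n) hR (f - c) = 0 := DFunLike.ext _ _ fun x => by
          rw [Lip0.mulOp_apply, Lip0.sub_apply, Lip0.zero_apply, mul_eq_zero]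
          by_cases hx : H n x = 0
          · exact Or.inl hx
          · right
            have h1 := abs_lt.1 (show |f x| < δ from hN n hn x hx)
            rw [hc, min_eq_left h1.2.le, max_eq_left h1.1.le, sub_self]
        exact (congrArg μ.1 h0).trans (map_zero _)
      have hle : ∀ n ≥ N, |τ.1 (f - c)| ≤ ε / 2 / 2 ^ n * ‖f - c‖ := fun n hn => by
        have h1 : τ.1 (f - c) = (τ - T n μ).1 (f - c) := by
          have : (τ - T n μ).1 (f - c) = τ.1 (f - c) - (T n μ).1 (f - c) := rfl
          rw [this, hT n hn, sub_zero]
        rw [h1]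
        exact (abs_apply_le _ _).trans (mul_le_mul_of_nonneg_right (hτ n) (norm_nonneg _))
      have h0 : Tendsto (fun n : ℕ => ε / 2 / 2 ^ n * ‖f - c‖) atTop (𝓝 0) := by
        simpa using (tendsto_div_two_pow_atTop_nhds_zero (ε / 2)).mul_const ‖f - c‖
      exact abs_nonpos_iff.1 (ge_of_tendsto h0 (eventually_atTop.2 ⟨N, hle⟩))
    have hτc : τ.1 f = τ.1 c := by
      rw [map_sub] at hfc
      exact sub_eq_zero.1 hfc
    rw [hτc]
    refine hF c hcn fun x _ => ?_
    rw [hc]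
    exact abs_le.2 ⟨le_max_right _ _, max_le (min_le_right _ _) (by linarith)⟩
  choose! γ hγ using hγ
  refine ⟨K, γ '' Γ, hK, fun U hUo hKU => isVStarSet_of_approx fun η hη => ?_, fun μ hμ =>
    ⟨γ μ, ⟨μ, hμ, rfl⟩, ?_⟩⟩
  · obtain ⟨N, hN⟩ := hU U hUo hKU
    have h0 := tendsto_div_two_pow_atTop_nhds_zero (ε / 2)
    obtain ⟨n, hnη, hn⟩ := ((h0.eventually_lt_const hη).and (eventually_ge_atTop N)).exists
    -- The support of the cutoff `H n` lies in `U`, so `T n` takes values in F(closure U) and `T'`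
    -- carries Γ to a (V*)-set there.
    obtain ⟨T', hT'⟩ := exists_comp_eq_of_forall_mem_range (LipFreeOn.toFree o (closure U))
      LipFreeOn.norm_toFree (T n) fun μ => LipFreeOn.exists_toFree_eq _ fun f hf => by
        have h0 : Lip0.mulOp (hH n) (hL n) hR f = 0 := DFunLike.ext _ _ fun x => by
          rw [Lip0.mulOp_apply, Lip0.zero_apply, mul_eq_zero]
          by_cases hx : H n x = 0
          · exact Or.inl hx
          · exact Or.inr (hf x (mem_insert_of_mem _ (subset_closure (hN n hn x hx))))
        exact (congrArg μ.1 h0).trans (map_zero _)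
    refine ⟨T' '' Γ, hΓ.image T', ?_⟩
    rintro _ ⟨_, ⟨μ, hμ, rfl⟩, rfl⟩
    refine ⟨T' μ, ⟨μ, hμ, rfl⟩, ?_⟩
    rw [← LipFreeOn.norm_toFree]
    have h1 : LipFreeOn.toFree o (closure U)
        (LipFreeOn.incl o (hKU.trans subset_closure) (γ μ) - T' μ) =
        LipFreeOn.toFree o K (γ μ) - T n μ := by
      rw [← hT' μ]
      exact map_sub (LipFreeOn.toFree o (closure U)) _ _
    rw [h1]
    exact (hγ μ hμ n).trans hnη.le
  · have h1 := (hlim μ hμ).1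
    have h2 := hγ μ hμ 0
    rw [pow_zero, div_one] at h2
    refine le_trans (norm_sub_le_of_intermediate μ (T 0 μ) _) ?_
    linarith [show ‖T 0 μ - μ‖ ≤ ε / 2 from h1]

end LipFree

end CompactReduction

/-! ### The five conditions and the conclusion -/

section CompactDetermination

variable {M : Type u} [MetricSpace M] {o : M}

/-- Every (V*)-set in some `F(K)`, `K` compact, with respect to all `F(closure U)`, `U ⊇ K` open, is
a (V*)-set with respect to `F(L)` for a compact `L ⊇ K`. -/
def VStarSetsAreCompactlySeen (o : M) : Prop :=
  ∀ K : Set M, IsCompact K → ∀ Γ : Set (LipFreeOn o K),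
    (∀ U : Set M, IsOpen U → ∀ hKU : K ⊆ U,
      IsVStarSet (LipFreeOn.incl o (hKU.trans subset_closure : K ⊆ closure U) '' Γ)) →
    ∃ (L : Set M) (hKL : K ⊆ L), IsCompact L ∧ IsVStarSet (LipFreeOn.incl o hKL '' Γ)

/-- WUC series in `Lip_0(K)`, `K` compact, extend to WUC series in `Lip_0(M)`. -/
def WUCSeriesExtend (o : M) : Prop :=
  ∀ K : Set M, IsCompact K → ∀ f : ℕ → Lip0On o K, IsWUC f →
    ∃ g : ℕ → Lip0 o, IsWUC g ∧ ∀ (n : ℕ) (x : ↥(insert o K)), g n x = f n x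

/-- The case `U = M` suffices: testing on the extended series shows that Γ is already a (V*)-set in
F(K), so `L = K` works. -/
theorem WUCSeriesExtend.vStarSetsAreCompactlySeen (h : WUCSeriesExtend o) :
    VStarSetsAreCompactlySeen o := by
  intro K hK Γ hΓ
  have hV : IsVStarSet Γ := by
    rw [LipFree.isVStarSet_iff_lip]
    intro f hf ε hε
    obtain ⟨g, hg, hgf⟩ := h K hK f hf
    have hwuc := hg.map (Lip0.compOp (o := base o (closure univ)) Subtype.val
      ⟨1, LipschitzWith.subtype_val _⟩ rfl)
    filter_upwards [LipFree.isVStarSet_iff_lip.1 (hΓ univ isOpen_univ (subset_univ K)) _ hwuc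
      ε hε] with n hn γ hγ
    have h1 := hn _ ⟨γ, hγ, rfl⟩
    rwa [show f n = Lip0.compOp (o := base o K) Subtype.val
      ⟨1, LipschitzWith.subtype_val _⟩ rfl (g n) from DFunLike.ext _ _ fun x => (hgf n x).symm]
  exact ⟨K, subset_rfl, hK, hV.image _⟩

theorem wucSeriesExtend_of_lipschitz_extension
    (h : ∀ K : Set M, IsCompact K → ∀ φ : K → lp (fun _ : ℕ => ℝ) 1,
      (∃ C : ℝ≥0, LipschitzWith C φ) → ∃ Φ : M → lp (fun _ : ℕ => ℝ) 1,
        (∃ C : ℝ≥0, LipschitzWith C Φ) ∧ ∀ x : K, Φ x = φ x) :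
    WUCSeriesExtend o := by
  intro K hK f hf
  obtain ⟨C, hC⟩ := hf.exists_sum_abs_sub_le
  have hmem : ∀ x, Memℓp (fun n => f n x) 1 := fun x => by
    refine memℓp_gen ?_
    refine summable_of_sum_le (c := C * dist x (base o K)) (fun _ => by positivity) fun F => ?_
    simpa [Lip0.apply_base] using hC F x (base o K)
  -- Extending from `insert o K` makes the coordinates of `Φ` vanish at `o`.
  obtain ⟨Φ, ⟨D, hD⟩, hΦ⟩ := h (insert o K) (hK.insert o) (fun x => ⟨fun n => f n x, hmem x⟩)
    ⟨C, LipschitzWith.of_dist_le_mul fun x y => by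
      rw [dist_eq_norm]
      refine lp.norm_le_of_forall_sum_le (by simp) (by positivity) fun F => ?_
      simp only [ENNReal.toReal_one, Real.rpow_one]
      exact hC F x y⟩
  have hsum : ∀ (F : Finset ℕ) (x y : M), ∑ n ∈ F, |Φ x n - Φ y n| ≤ D * dist x y :=
    fun F x y => by
      refine le_trans ?_ (hD.dist_le_mul x y)
      rw [dist_eq_norm]
      simpa using lp.sum_rpow_le_norm_rpow (p := 1) (by simp) (Φ x - Φ y) F
  have hval : ∀ (n : ℕ) (x : ↥(insert o K)), Φ x n = f n x := fun n x => by rw [hΦ x]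
  refine ⟨fun n => Lip0.mk (fun x => Φ x n)
    (Lip0.exists_lipschitz_of_abs_sub_le (C := D) fun x y => by simpa using hsum {n} x y)
    ((hval n (base o K)).trans (f n).apply_base),
    Lip0.isWUC_of_sum_abs_sub_le D.2 hsum, hval⟩

/-- The linearized retraction maps F(M) to F(L) and fixes F(K), and operators preserve (V*)-sets.
Taking `L ⊇ insert o K` makes the retraction fix the base point. -/
theorem vStarSetsAreCompactlySeen_of_retract
    (h : ∀ K : Set M, IsCompact K → ∃ L : Set M, IsCompact L ∧ K ⊆ L ∧
      ∃ π : M → M, (∃ C : ℝ≥0, LipschitzWith C π) ∧ (∀ x, π x ∈ L) ∧ ∀ x ∈ L, π x = x) :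
    VStarSetsAreCompactlySeen o := by
  intro K hK Γ hΓ
  obtain ⟨L, hL, hKL, π, ⟨C, hC⟩, hπL, hπ⟩ := h (insert o K) (hK.insert o)
  have hKL' : K ⊆ L := (subset_insert o K).trans hKL
  refine ⟨L, hKL', hL, ?_⟩
  let p : ↥(insert o (closure (univ : Set M))) → ↥(insert o L) :=
    fun x => ⟨π x, mem_insert_of_mem _ (hπL x)⟩
  have hp : ∃ C : ℝ≥0, LipschitzWith C p :=
    ⟨C, LipschitzWith.of_dist_le_mul fun x y => hC.dist_le_mul x y⟩
  have hp0 : p (base o _) = base o L := Subtype.ext (hπ o (hKL (mem_insert o K)))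
  have himg := (hΓ univ isOpen_univ (subset_univ K)).image (Y := LipFreeOn o L)
    (LipFree.map p hp hp0)
  have heq : ∀ γ : LipFreeOn o K, LipFree.map p hp hp0
      (LipFreeOn.incl o ((subset_univ K).trans subset_closure) γ) = LipFreeOn.incl o hKL' γ :=
    fun γ => Subtype.ext <| ContinuousLinearMap.ext fun f => congrArg γ.1 <|
      DFunLike.ext _ _ fun x => congrArg f (Subtype.ext (hπ x (hKL x.2)))
  rw [image_image] at himg
  rwa [image_congr fun γ _ => (heq γ).symm]

theorem VStarSetsAreCompactlySeen.compactlyDetermined [CompleteSpace M]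
    (h : VStarSetsAreCompactlySeen o) : CompactlyDetermined HasPropertyVStar o := by
  intro hK Γ hΓ
  refine isRelWeaklyCompact_of_approx fun ε hε => ?_
  obtain ⟨K, Γ', hKc, hΓ', hap⟩ := LipFree.exists_compact_approx_of_isVStarSet hΓ hε
  obtain ⟨L, hKL, hL, hV⟩ := h K hKc Γ' hΓ'
  refine ⟨_, (hK L hL _ hV).image (LipFreeOn.toFree o L), fun μ hμ => ?_⟩
  obtain ⟨γ, hγ, hle⟩ := hap μ hμ
  exact ⟨_, ⟨_, ⟨γ, hγ, rfl⟩, rfl⟩, hle⟩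

end CompactDetermination

end

theorem proposition2p11 {M : Type u} [MetricSpace M] [CompleteSpace M] (o : M)
    (h :
      -- (a)
      (∀ (K : Set M), IsCompact K → ∀ Γ : Set (LipFreeOn o K),
        (∀ (U : Set M), IsOpen U → ∀ hKU : K ⊆ U,
          IsVStarSet (LipFreeOn.incl o (hKU.trans subset_closure : K ⊆ closure U) '' Γ)) →
        ∃ (L : Set M) (hKL : K ⊆ L), IsCompact L ∧
          IsVStarSet (LipFreeOn.incl o hKL '' Γ)) ∨
      -- (b)
      (∀ (K : Set M), IsCompact K → ∀ f : ℕ → Lip0On o K, IsWUC f →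
        ∃ g : ℕ → Lip0 o, IsWUC g ∧ ∀ (n : ℕ) (x : ↥(insert o K)), g n x = f n x) ∨
      -- (c)
      (∀ (K : Set M), IsCompact K → ∀ φ : K → lp (fun _ : ℕ => ℝ) 1,
        (∃ C : ℝ≥0, LipschitzWith C φ) →
        ∃ Φ : M → lp (fun _ : ℕ => ℝ) 1,
          (∃ C : ℝ≥0, LipschitzWith C Φ) ∧ ∀ x : K, Φ x = φ x) ∨
      -- (d)
      (∀ (K : Set M), IsCompact K →
        ∃ E : Lip0On o K →L[ℝ] Lip0 o,
          ∀ (f : Lip0On o K) (x : ↥(insert o K)), E f x = f x) ∨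
      -- (e)
      (∀ (K : Set M), IsCompact K →
        ∃ L : Set M, IsCompact L ∧ K ⊆ L ∧
          ∃ π : M → M, (∃ C : ℝ≥0, LipschitzWith C π) ∧ (∀ x, π x ∈ L) ∧ ∀ x ∈ L, π x = x)) :
    CompactlyDetermined HasPropertyVStar o := by
  have ha : VStarSetsAreCompactlySeen o := by
    rcases h with h | h | h | h | h
    · exact h
    · exact WUCSeriesExtend.vStarSetsAreCompactlySeen h
    · exact (wucSeriesExtend_of_lipschitz_extension h).vStarSetsAreCompactlySeen
    · refine WUCSeriesExtend.vStarSetsAreCompactlySeen fun K hK f hf => ?_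
      obtain ⟨E, hE⟩ := h K hK
      exact ⟨fun n => E (f n), hf.map E, fun n => hE (f n)⟩
    · exact vStarSetsAreCompactlySeen_of_retract h
  exact ha.compactlyDetermined
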